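/- Let $0<\varepsilon<2$ and, for $x\in(0,1)$, put $$p(x)=(1-x)^{1+1/\varepsilon}(1+x)^{1-1/\varepsilon},\qquad w(x)=x^{-1}(1-x)^{1/\varepsilon}(1+x)^{-1/\varepsilon}.$$ Let $L$ be the operator $Lf=-w^{-1}(pf')'$ on $L^2((0,1),w(x)\,dx)$ with domain $\{f\in C^\infty([0,1]): f(0)=0\}$; let $\bar L$ denote its closure. Define $$\psi(t)=\int_0^t\sqrt{\frac{w(y)}{p(y)}}\,dy\quad(t\in[0,1]),\qquad \beta=\psi(1).$$ Then $\beta<\infty$ and $\psi:[0,1]\to[0,\beta]$ is a bijection. Let $\varphi=\psi^{-1}$ and, for $s\in(0,\beta)$, $$c(s)=\bigl(w(\varphi(s))\,p(\varphi(s))\bigr)^{-1/4},\qquad V(s)=-c(s)c''(s)\frac{p(\varphi(s))}{\varphi'(s)}-c(s)c'(s)\frac{d}{ds}\!\left(\frac{p(\varphi(s))}{\varphi'(s)}\right),$$ $$\hat Q_c(g)=\int_0^\beta\bigl(|g'(s)|^2+V(s)|g(s)|^2\bigr)\,ds\qquad(g\in C_c^\infty(0,\beta)\subset L^2(0,\beta)).$$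 Here $\varphi$ and $c$ are smooth on $(0,\beta)$ and $\varphi'\neq0$ there, so that these expressions are well defined. Moreover: 1. $\hat Q_c$ is a finite, non-negative and closable quadratic form, and its closure $\hat Q$ (a closed form) is associated with a self-adjoint operator $H$ on $L^2(0,\beta)$: $f\in\operatorname{Dom}(H)$ with $Hf=k$ if and only if $f\in\operatorname{Dom}(\hat Q)$ and $\hat Q(f,g)=\langle k,g\rangle$ for all $g\in\operatorname{Dom}(\hat Q)$. 2. $L$ is closable, the formula $(Uf)(s)=c(s)^{-1}f(\varphi(s))$ defines a unitary operator $U:L^2((0,1),w(x)\,dx)\to L^2(0,\beta)$, and $H=U\bar LU^{-1}$, including equality of domains. 3. $V$ is smooth on $(0,\beta)$, $V(s)\sim\frac34 s^{-2}$ as $s\to0+$, and $V(s)\sim\left(\frac1{\varepsilon^2}-\frac14\right)(\beta-s)^{-2}$ as $s\to\beta-$. -/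

import Mathlib

open MeasureTheory Set Filter Topology
open scoped ContDiff Distributions InnerProductSpace

noncomputable section

namespace LiouvilleSchrodinger

/-! ### Coefficients and the change of variables -/

/-- `p(x) = (1 - x)^{1 + 1/ε} (x + 1)^{1 - 1/ε}` -/
def p (ε x : ℝ) : ℝ := (1 - x) ^ (1 + 1 / ε) * (x + 1) ^ (1 - 1 / ε)

/-- `w(x) = x⁻¹ (1 - x)^{1/ε} (x + 1)^{-1/ε}` -/
def w (ε x : ℝ) : ℝ := x⁻¹ * (1 - x) ^ (1 / ε) * (x + 1) ^ (-(1 / ε))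

/-- `ψ(t) = ∫₀ᵗ √(w/p)` -/
def psi (ε t : ℝ) : ℝ := ∫ y in (0 : ℝ)..t, Real.sqrt (w ε y / p ε y)

/-- `β = ψ(1)` -/
def beta (ε : ℝ) : ℝ := psi ε 1

/-- `φ = ψ⁻¹ : [0, β] → [0, 1]` -/
def phi (ε : ℝ) : ℝ → ℝ := Function.invFunOn (psi ε) (Icc 0 1)

/-- `c(s) = (w(φ(s)) p(φ(s)))^{-1/4}` -/
def c (ε s : ℝ) : ℝ := (w ε (phi ε s) * p ε (phi ε s)) ^ (-(1 / 4) : ℝ)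

/-- `V = - c c'' (p ∘ φ)/φ' - c c' ((p ∘ φ)/φ')'` -/
def V (ε s : ℝ) : ℝ :=
  -(c ε s * deriv (deriv (c ε)) s * (p ε (phi ε s) / deriv (phi ε) s))
    - c ε s * deriv (c ε) s * deriv (fun r => p ε (phi ε r) / deriv (phi ε) r) s

/-! ### The Hilbert spaces -/

/-- the measure `w(x) dx` on `(0, 1)` -/
def weightMeasure (ε : ℝ) : Measure ℝ :=
  (volume.restrict (Ioo 0 1)).withDensity fun x => ENNReal.ofReal (w ε x)

/-- `L²((0, 1), w(x) dx)` -/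
abbrev L2w (ε : ℝ) : Type := Lp ℂ 2 (weightMeasure ε)

/-- `L²(0, b)` -/
abbrev L2 (b : ℝ) : Type := Lp ℂ 2 (volume.restrict (Ioo 0 b))

/-! ### The Sturm-Liouville operator -/

/-- `C₀^∞([0, 1])`: functions that are smooth on `[0, 1]` and vanish at `0`. -/
def smoothVanishing : Submodule ℂ (ℝ → ℂ) where
  carrier := {f | ContDiffOn ℝ ∞ f (Icc 0 1) ∧ f 0 = 0}
  zero_mem' := ⟨contDiffOn_const, rfl⟩
  add_mem' := fun hf hg => ⟨hf.1.add hg.1, by simp [hf.2, hg.2]⟩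
  smul_mem' := fun a _ hf => ⟨contDiffOn_const.smul hf.1, by simp [hf.2]⟩

/-- the differential expression `-w⁻¹ (p f')'` -/
def slExpr (ε : ℝ) (f : ℝ → ℂ) (x : ℝ) : ℂ :=
  -((w ε x)⁻¹ • deriv (fun y => p ε y • deriv f y) x)

theorem w_pos (ε : ℝ) {x : ℝ} (hx : x ∈ Ioo (0 : ℝ) 1) : 0 < w ε x := by
  have h1 : 0 < 1 - x := by linarith [hx.2]
  have h2 : 0 < x + 1 := by linarith [hx.1]
  have h3 := hx.1
  unfold w
  positivity

theorem measurable_w (ε : ℝ) : Measurable (w ε) := by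
  unfold w
  fun_prop

theorem ae_weight_iff (ε : ℝ) (P : ℝ → Prop) :
    (∀ᵐ x ∂weightMeasure ε, P x) ↔ ∀ᵐ x ∂volume.restrict (Ioo (0 : ℝ) 1), P x := by
  have hm : Measurable fun x => ENNReal.ofReal (w ε x) := (measurable_w ε).ennreal_ofReal
  rw [weightMeasure, ae_withDensity_iff hm, ae_restrict_iff' measurableSet_Ioo,
    ae_restrict_iff' measurableSet_Ioo]
  refine eventually_congr (Eventually.of_forall fun x => ?_)
  refine forall_congr' fun hx => ?_
  have : ENNReal.ofReal (w ε x) ≠ 0 := by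
    simpa using w_pos ε hx
  simp [this]

theorem hasDerivAt_p (ε : ℝ) {x : ℝ} (hx : x ∈ Ioo (0 : ℝ) 1) :
    HasDerivAt (p ε) (-2 * (x + 1 / ε) * (x * w ε x)) x := by
  have h1 : 0 < 1 - x := by linarith [hx.2]
  have h2 : 0 < x + 1 := by linarith [hx.1]
  have h3 : x ≠ 0 := hx.1.ne'
  have d1 : HasDerivAt (fun y : ℝ => (1 - y) ^ (1 + 1 / ε))
      (-1 * (1 + 1 / ε) * (1 - x) ^ (1 + 1 / ε - 1)) x :=
    ((hasDerivAt_id x).const_sub 1).rpow_const (Or.inl h1.ne')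
  have d2 : HasDerivAt (fun y : ℝ => (y + 1) ^ (1 - 1 / ε))
      (1 * (1 - 1 / ε) * (x + 1) ^ (1 - 1 / ε - 1)) x :=
    ((hasDerivAt_id x).add_const 1).rpow_const (Or.inl h2.ne')
  refine (d1.mul d2).congr_deriv ?_
  have e1 : (1 - x) ^ (1 + 1 / ε) = (1 - x) * (1 - x) ^ (1 / ε) := by
    rw [Real.rpow_add h1, Real.rpow_one]
  have e2 : (x + 1) ^ (1 - 1 / ε) = (x + 1) * (x + 1) ^ (-(1 / ε)) := by
    rw [sub_eq_add_neg, Real.rpow_add h2, Real.rpow_one]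
  have e3 : (1 + 1 / ε - 1 : ℝ) = 1 / ε := by ring
  have e4 : (1 - 1 / ε - 1 : ℝ) = -(1 / ε) := by ring
  rw [e3, e4, e1, e2, w]
  field_simp
  ring

theorem p_eq (ε : ℝ) {x : ℝ} (hx : x ∈ Ioo (0 : ℝ) 1) :
    p ε x = x * (1 - x) * (x + 1) * w ε x := by
  have h1 : 0 < 1 - x := by linarith [hx.2]
  have h2 : 0 < x + 1 := by linarith [hx.1]
  have h3 : x ≠ 0 := hx.1.ne'
  rw [p, w, Real.rpow_add h1, Real.rpow_one, sub_eq_add_neg 1 (1 / ε), Real.rpow_add h2,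
    Real.rpow_one]
  field_simp

theorem contDiffAt_of_smooth {f : ℝ → ℂ} (hf : f ∈ smoothVanishing) {x : ℝ}
    (hx : x ∈ Ioo (0 : ℝ) 1) : ContDiffAt ℝ ∞ f x :=
  hf.1.contDiffAt (Icc_mem_nhds hx.1 hx.2)

theorem differentiableAt_deriv {f : ℝ → ℂ} (hf : f ∈ smoothVanishing) {x : ℝ}
    (hx : x ∈ Ioo (0 : ℝ) 1) : DifferentiableAt ℝ (deriv f) x := by
  have h2 : ContDiffOn ℝ 1 (deriv f) (Ioo 0 1) :=
    (hf.1.mono Ioo_subset_Icc_self).deriv_of_isOpen isOpen_Ioo (by norm_cast)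
  exact (h2.contDiffAt (isOpen_Ioo.mem_nhds hx)).differentiableAt (by norm_num)

theorem slExpr_eq (ε : ℝ) {f : ℝ → ℂ} (hf : f ∈ smoothVanishing) {x : ℝ}
    (hx : x ∈ Ioo (0 : ℝ) 1) :
    slExpr ε f x = x • (-((1 - x) * (x + 1)) • deriv (deriv f) x + (2 * (x + 1 / ε)) • deriv f x) := by
  have hw := (w_pos ε hx).ne'
  have h := (hasDerivAt_p ε hx).fun_smul (differentiableAt_deriv hf hx).hasDerivAt
  rw [slExpr, h.deriv, p_eq ε hx, smul_add, smul_smul, smul_smul, smul_add, smul_smul, smul_smul,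
    neg_add, ← neg_smul, ← neg_smul]
  congr 2 <;> field_simp

theorem slExpr_add (ε : ℝ) {f g : ℝ → ℂ} (hf : f ∈ smoothVanishing) (hg : g ∈ smoothVanishing)
    {x : ℝ} (hx : x ∈ Ioo (0 : ℝ) 1) :
    slExpr ε (f + g) x = slExpr ε f x + slExpr ε g x := by
  have d : ∀ y ∈ Ioo (0 : ℝ) 1, deriv (f + g) y = (deriv f + deriv g) y := fun y hy =>
    deriv_add ((contDiffAt_of_smooth hf hy).differentiableAt (by norm_num))
      ((contDiffAt_of_smooth hg hy).differentiableAt (by norm_num))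
  have d2 : deriv (deriv (f + g)) x = deriv (deriv f) x + deriv (deriv g) x := by
    rw [Filter.EventuallyEq.deriv_eq
      (eventually_of_mem (isOpen_Ioo.mem_nhds hx) d : deriv (f + g) =ᶠ[𝓝 x] _)]
    exact deriv_add (differentiableAt_deriv hf hx) (differentiableAt_deriv hg hx)
  rw [slExpr_eq ε (add_mem hf hg) hx, slExpr_eq ε hf hx, slExpr_eq ε hg hx, d2, d x hx]
  simp only [Pi.add_apply, smul_add]
  abel

theorem slExpr_smul (ε : ℝ) (a : ℂ) (f : ℝ → ℂ) (x : ℝ) :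
    slExpr ε (a • f) x = a • slExpr ε f x := by
  have d : (fun y => p ε y • deriv (a • f) y) = a • fun y => p ε y • deriv f y := by
    ext y
    rw [deriv_const_smul_field, Pi.smul_apply, smul_comm]
  rw [slExpr, slExpr, d, deriv_const_smul_field, smul_comm, smul_neg]

theorem slExpr_zero_of_ae (ε : ℝ) {f : ℝ → ℂ} (hf : f ∈ smoothVanishing)
    (h : f =ᵐ[weightMeasure ε] 0) : slExpr ε f =ᵐ[weightMeasure ε] 0 := by
  have h0 : EqOn f 0 (Ioo 0 1) :=
    Measure.eqOn_open_of_ae_eq ((ae_weight_iff ε _).1 h) isOpen_Ioo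
      (hf.1.continuousOn.mono Ioo_subset_Icc_self) continuousOn_const
  refine (ae_weight_iff ε _).2 ?_
  filter_upwards [ae_restrict_mem measurableSet_Ioo] with x hx
  have d : ∀ y ∈ Ioo (0 : ℝ) 1, deriv f y = (0 : ℝ → ℂ) y := fun y hy => by
    rw [Filter.EventuallyEq.deriv_eq
      (eventually_of_mem (isOpen_Ioo.mem_nhds hy) h0 : f =ᶠ[𝓝 y] 0)]
    simp
  have d2 : deriv (deriv f) x = 0 := by
    rw [Filter.EventuallyEq.deriv_eq
      (eventually_of_mem (isOpen_Ioo.mem_nhds hx) d : deriv f =ᶠ[𝓝 x] _)]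
    simp
  rw [slExpr_eq ε hf hx, d2, d x hx]
  simp

/-- the graph `{(f, -w⁻¹ (p f')') | f ∈ C₀^∞([0, 1])}` in `L²(w dx) × L²(w dx)` -/
def slGraph (ε : ℝ) : Submodule ℂ (L2w ε × L2w ε) where
  carrier := {P | ∃ f ∈ smoothVanishing,
    P.1 =ᵐ[weightMeasure ε] f ∧ P.2 =ᵐ[weightMeasure ε] slExpr ε f}
  zero_mem' := by
    refine ⟨0, zero_mem _, Lp.coeFn_zero _ _ _, (Lp.coeFn_zero _ _ _).trans ?_⟩
    exact (slExpr_zero_of_ae ε (zero_mem _) ae_eq_rfl).symm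
  add_mem' := by
    rintro ⟨F, F'⟩ ⟨G, G'⟩ ⟨f, hf, h1, h2⟩ ⟨g, hg, h3, h4⟩
    refine ⟨f + g, add_mem hf hg, (Lp.coeFn_add F G).trans (h1.add h3),
      (Lp.coeFn_add F' G').trans ((h2.add h4).trans ((ae_weight_iff ε _).2 ?_))⟩
    filter_upwards [ae_restrict_mem measurableSet_Ioo] with x hx
    exact (slExpr_add ε hf hg hx).symm
  smul_mem' := by
    rintro a ⟨F, F'⟩ ⟨f, hf, h1, h2⟩
    refine ⟨a • f, Submodule.smul_mem _ a hf, (Lp.coeFn_smul a F).trans (h1.const_smul a),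
      (Lp.coeFn_smul a F').trans ((h2.const_smul a).trans (Eventually.of_forall fun x => ?_))⟩
    exact (slExpr_smul ε a f x).symm

theorem slGraph_single_valued (ε : ℝ) (P : L2w ε × L2w ε) (hP : P ∈ slGraph ε) (h0 : P.1 = 0) :
    P.2 = 0 := by
  obtain ⟨f, hf, h1, h2⟩ := hP
  rw [h0] at h1
  have := slExpr_zero_of_ae ε hf (h1.symm.trans (Lp.coeFn_zero _ _ _))
  exact Lp.ext ((h2.trans this).trans (Lp.coeFn_zero _ _ _).symm)

/-- The operator `L f = -w⁻¹ (p f')'` on `C₀^∞([0, 1])`. -/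
def sturmLiouville (ε : ℝ) : L2w ε →ₗ.[ℂ] L2w ε := (slGraph ε).toLinearPMap

theorem sturmLiouville_graph (ε : ℝ) : (sturmLiouville ε).graph = slGraph ε :=
  Submodule.toLinearPMap_graph_eq _ (slGraph_single_valued ε)

theorem memLp_of_bound {ε : ℝ} (hε : 0 < ε) {h : ℝ → ℂ} (hc : ContinuousOn h (Ioo 0 1)) (C : ℝ)
    (hC : ∀ x ∈ Ioo (0 : ℝ) 1, ‖h x‖ ≤ C * x) : MemLp h 2 (weightMeasure ε) := by
  have hm : AEStronglyMeasurable h (volume.restrict (Ioo 0 1)) :=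
    hc.aestronglyMeasurable measurableSet_Ioo
  have hmw : AEStronglyMeasurable h (weightMeasure ε) :=
    hm.mono_ac (withDensity_absolutelyContinuous _ _)
  rw [memLp_two_iff_integrable_sq_norm hmw, weightMeasure,
    integrable_withDensity_iff (measurable_w ε).ennreal_ofReal (by simp)]
  refine Integrable.of_bound ?_ (C ^ 2) ?_
  · exact (hm.norm.pow 2).mul
      (measurable_w ε).ennreal_ofReal.ennreal_toReal.aestronglyMeasurable
  · filter_upwards [ae_restrict_mem measurableSet_Ioo] with x hx
    have hw := w_pos ε hx
    have h1 : 0 < 1 - x := by linarith [hx.2]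
    have h2 : 1 ≤ x + 1 := by linarith [hx.1]
    have e1 : (1 - x) ^ (1 / ε) ≤ 1 :=
      Real.rpow_le_one h1.le (by linarith [hx.1]) (by positivity)
    have e2 : (x + 1) ^ (-(1 / ε)) ≤ 1 :=
      Real.rpow_le_one_of_one_le_of_nonpos h2 (by simp [hε.le])
    have hwx : w ε x ≤ x⁻¹ := by
      have := hx.1
      unfold w
      rw [mul_assoc]
      refine mul_le_of_le_one_right (by positivity) ?_
      exact mul_le_one₀ e1 (by positivity) e2
    have hb : ‖h x‖ ^ 2 ≤ (C * x) ^ 2 := by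
      gcongr
      exact hC x hx
    rw [ENNReal.toReal_ofReal hw.le, Real.norm_of_nonneg (by positivity)]
    calc ‖h x‖ ^ 2 * w ε x ≤ (C * x) ^ 2 * x⁻¹ := by gcongr
      _ = C ^ 2 * x := by
        have := hx.1.ne'
        field_simp
      _ ≤ C ^ 2 := mul_le_of_le_one_right (by positivity) hx.2.le

/-- Every `f ∈ C₀^∞([0, 1])` belongs to the domain of `L`. -/
theorem exists_mem_slGraph {ε : ℝ} (hε : 0 < ε) {f : ℝ → ℂ} (hf : f ∈ smoothVanishing) :
    ∃ (h1 : MemLp f 2 (weightMeasure ε)) (h2 : MemLp (slExpr ε f) 2 (weightMeasure ε)),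
      (h1.toLp f, h2.toLp (slExpr ε f)) ∈ (sturmLiouville ε).graph := by
  have hI : UniqueDiffOn ℝ (Icc (0 : ℝ) 1) := uniqueDiffOn_Icc zero_lt_one
  have c1 : ContDiffOn ℝ ∞ (derivWithin f (Icc 0 1)) (Icc 0 1) := hf.1.derivWithin hI (by norm_cast)
  have c2 : ContDiffOn ℝ ∞ (derivWithin (derivWithin f (Icc 0 1)) (Icc 0 1)) (Icc 0 1) :=
    c1.derivWithin hI (by norm_cast)
  obtain ⟨A, hA⟩ := isCompact_Icc.exists_bound_of_continuousOn c1.continuousOn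
  obtain ⟨B, hB⟩ := isCompact_Icc.exists_bound_of_continuousOn c2.continuousOn
  have e1 : ∀ x ∈ Ioo (0 : ℝ) 1, deriv f x = derivWithin f (Icc 0 1) x := fun x hx =>
    (derivWithin_of_mem_nhds (Icc_mem_nhds hx.1 hx.2)).symm
  have e2 : ∀ x ∈ Ioo (0 : ℝ) 1,
      deriv (deriv f) x = derivWithin (derivWithin f (Icc 0 1)) (Icc 0 1) x := fun x hx => by
    rw [derivWithin_of_mem_nhds (Icc_mem_nhds hx.1 hx.2)]
    exact Filter.EventuallyEq.deriv_eq
      (eventually_of_mem (isOpen_Ioo.mem_nhds hx) e1 : deriv f =ᶠ[𝓝 x] _)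
  have h1 : MemLp f 2 (weightMeasure ε) := by
    refine memLp_of_bound hε (hf.1.continuousOn.mono Ioo_subset_Icc_self) A fun x hx => ?_
    have := (convex_Icc (0 : ℝ) 1).norm_image_sub_le_of_norm_derivWithin_le
      (hf.1.differentiableOn (by norm_num)) hA (left_mem_Icc.2 zero_le_one)
      (Ioo_subset_Icc_self hx)
    simpa [hf.2, abs_of_pos hx.1] using this
  have hL : EqOn (slExpr ε f) (fun x => x • (-((1 - x) * (x + 1)) •
      derivWithin (derivWithin f (Icc 0 1)) (Icc 0 1) x
        + (2 * (x + 1 / ε)) • derivWithin f (Icc 0 1) x)) (Ioo 0 1) := fun x hx => by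
    rw [slExpr_eq ε hf hx, e1 x hx, e2 x hx]
  have h2 : MemLp (slExpr ε f) 2 (weightMeasure ε) := by
    have k1 := c1.continuousOn.mono Ioo_subset_Icc_self
    have k2 := c2.continuousOn.mono Ioo_subset_Icc_self
    refine memLp_of_bound hε (ContinuousOn.congr (by fun_prop) hL) (B + 2 * (1 + 1 / ε) * A)
      fun x hx => ?_
    have hx' := Ioo_subset_Icc_self hx
    have b1 := hA x hx'
    have b2 := hB x hx'
    have i1 : |(1 - x) * (x + 1)| ≤ 1 := by
      rw [abs_le]
      constructor <;> nlinarith [hx.1, hx.2]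
    have i2 : |2 * (x + 1 / ε)| ≤ 2 * (1 + 1 / ε) := by
      have := hx.1
      rw [abs_of_nonneg (by positivity)]
      linarith [hx.2]
    rw [hL hx, norm_smul, Real.norm_of_nonneg hx.1.le, mul_comm]
    refine mul_le_mul_of_nonneg_right ((norm_add_le _ _).trans ?_) hx.1.le
    rw [norm_smul, norm_smul, norm_neg, Real.norm_eq_abs, Real.norm_eq_abs]
    have := mul_le_mul i1 b2 (norm_nonneg _) zero_le_one
    have := mul_le_mul i2 b1 (norm_nonneg _) (by positivity)
    linarith
  refine ⟨h1, h2, ?_⟩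
  rw [sturmLiouville_graph]
  exact ⟨f, hf, h1.coeFn_toLp, h2.coeFn_toLp⟩

/-! ### Quadratic forms, their closures and the associated operators -/

section Forms

variable {D E : Type*} [AddCommGroup D] [NormedAddCommGroup E] [InnerProductSpace ℂ E]

/-- For a quadratic form `q` on a space `D`, regarded as a subspace of `E` by means of `ι`:
the sequence `u` in `D` converges in `E` to `x` and is Cauchy with respect to `q`. -/
def FormConverges (ι : D → E) (q : D → ℝ) (u : ℕ → D) (x : E) : Prop :=
  Tendsto (fun n => ι (u n)) atTop (𝓝 x) ∧
    Tendsto (fun mn : ℕ × ℕ => q (u mn.1 - u mn.2)) atTop (𝓝 0)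

/-- The form `q` is closable. -/
def IsClosableForm (ι : D → E) (q : D → ℝ) : Prop :=
  ∀ u : ℕ → D, FormConverges ι q u 0 → Tendsto (fun n => q (u n)) atTop (𝓝 0)

variable (E) in
/-- A sesquilinear form defined on a subspace of `E`
(conjugate linear in the first argument, as the inner product). -/
structure SesqForm where
  /-- the domain of the form -/
  domain : Submodule ℂ E
  /-- the form -/
  form : domain →ₗ⋆[ℂ] domain →ₗ[ℂ] ℂ

/-- The form `a` is closed: its domain is complete for the norm `(a(f, f) + ‖f‖²)^{1/2}`. -/
def SesqForm.IsClosed (a : SesqForm E) : Prop :=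
  ∀ (u : ℕ → a.domain) (x : E),
    FormConverges (fun f : a.domain => (f : E)) (fun f => (a.form f f).re) u x →
      ∃ hx : x ∈ a.domain,
        Tendsto (fun n => (a.form (u n - ⟨x, hx⟩) (u n - ⟨x, hx⟩)).re) atTop (𝓝 0)

/-- `a` is the closure of the quadratic form `q`. -/
def SesqForm.IsClosureOf (a : SesqForm E) (ι : D → E) (q : D → ℝ) : Prop :=
  (∀ x : E, x ∈ a.domain ↔ ∃ u : ℕ → D, FormConverges ι q u x) ∧
    ∀ (x : a.domain) (u : ℕ → D), FormConverges ι q u x →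
      Tendsto (fun n => (q (u n) : ℂ)) atTop (𝓝 (a.form x x))

/-- `T` is the operator associated with the form `a`: a vector `f` belongs to the domain of `T`,
with `T f = k`, if and only if `f` belongs to the domain of `a` and `a(g, f) = ⟪g, k⟫` for all `g`
in the domain of `a`. -/
def SesqForm.IsAssociated (a : SesqForm E) (T : E →ₗ.[ℂ] E) : Prop :=
  ∀ f k : E, (f, k) ∈ T.graph ↔
    ∃ hf : f ∈ a.domain, ∀ g : a.domain, a.form g ⟨f, hf⟩ = ⟪(g : E), k⟫_ℂ

end Forms

/-! ### The Schrödinger form -/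

/-- `C_c^∞(0, b)` -/
abbrev Test (b : ℝ) : Type := 𝓓((⟨Ioo 0 b, isOpen_Ioo⟩ : TopologicalSpace.Opens ℝ), ℂ)

theorem Test.memLp {b : ℝ} (g : Test b) : MemLp g 2 (volume.restrict (Ioo 0 b)) :=
  g.continuous.memLp_of_hasCompactSupport g.hasCompactSupport

/-- the inclusion of `C_c^∞(0, b)` in `L²(0, b)` -/
def Test.toL2 {b : ℝ} (g : Test b) : L2 b := g.memLp.toLp g

/-- the integrand `|g'|² + V |g|²` -/
def schrodingerDensity (ε : ℝ) (g : Test (beta ε)) (s : ℝ) : ℝ :=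
  ‖deriv g s‖ ^ 2 + V ε s * ‖g s‖ ^ 2

/-- the form `∫₀^β (|g'|² + V |g|²)` on `C_c^∞(0, β)` -/
def schrodingerForm (ε : ℝ) (g : Test (beta ε)) : ℝ :=
  ∫ s in Ioo 0 (beta ε), schrodingerDensity ε g s

end LiouvilleSchrodinger

end

/-! Put `a = 1/c = (w p)^{1/4} ∘ φ` and `θ = a'/a`. Since `(p ∘ φ)/φ' = a²`, the potential is `V =
-c (c' a²)' = a''/a = θ' + θ²`, and an integration by parts turns the form on test functions into
`‖A g‖²` with `A g = g' - θ g` (`V_eq`, `Test.norm_sq_twist`). So the form is nonnegative, and it is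
closable because `A` has the formal adjoint `h ↦ -(h' + θ h)` on the dense space of test functions
(`Test.twist_closable`).

The form has a positive lower bound. The function `φ/c` is the transform of `f(x) = x`, and `L x = 2
(x + 1/ε) x`; hence `V - 2 (φ + 1/ε)` is again of the shape `θ₁' + θ₁²`, and the form dominates
`(2/ε) ‖g‖²` (`poincare`). Therefore `A g ↦ g` extends to a bounded map `T` (`twistInv`) from the
closure of the range of `A` to `L²(0, β)`. It is injective because `A` is closable. The closed form
is `⟪T⁻¹ f, T⁻¹ g⟫` on the range of `T`, and its operator is `H = (T T†)⁻¹`, self-adjoint as the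
inverse of a bounded symmetric injective operator.

For the comparison with `L`, the factorization `U L f = A† A U f` holds pointwise, with `A†` the
formal adjoint. Cutoffs approximate `U f` in form norm (`tendsto_twist_cutoffTest`), so `U` carries
the graph of `L` into that of `H` (`transform_mem_graph`). Conversely `-(p f')' = k` is solved
explicitly for `k ∈ C_c^∞(0, 1)`, so the transformed range of `L` contains all test functions. As
`H⁻¹` is bounded, a restriction of `H` with dense range is a core (`inverseOp_graph_eq_closure`),
and the closure of `U L U⁻¹` is all of `H`.

The asymptotics of `V` follow from its rational expression in `φ`, together with `φ ~ s²/4` at `0`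
and `1 - φ ~ (β - s)²/2` at `β`. -/

noncomputable section

namespace LiouvilleSchrodinger

/-! ### Closed forms and self-adjoint operators built from a bounded injective map. -/

section AbstractForm

variable {E K : Type*} [NormedAddCommGroup E] [InnerProductSpace ℂ E]
  [NormedAddCommGroup K] [InnerProductSpace ℂ K]

/-- The form `(f, g) ↦ ⟪T⁻¹ f, T⁻¹ g⟫` on the range of an injective operator `T`. -/
def rangeForm (T : K →L[ℂ] E) (hT : Function.Injective T) : SesqForm E where
  domain := LinearMap.range T.toLinearMap
  form := LinearMap.mk₂'ₛₗ (starRingEnd ℂ) (RingHom.id ℂ)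
    (fun f g => ⟪(LinearEquiv.ofInjective T.toLinearMap hT).symm f,
      (LinearEquiv.ofInjective T.toLinearMap hT).symm g⟫_ℂ)
    (fun _ _ _ => by rw [map_add, inner_add_left])
    (fun _ _ _ => by rw [map_smul, inner_smul_left, smul_eq_mul])
    (fun _ _ _ => by rw [map_add, inner_add_right])
    (fun _ _ _ => by rw [map_smul, inner_smul_right, RingHom.id_apply, smul_eq_mul])

theorem mem_rangeForm (T : K →L[ℂ] E) (hT : Function.Injective T) (u : K) :
    T u ∈ (rangeForm T hT).domain := ⟨u, rfl⟩

theorem rangeForm_apply (T : K →L[ℂ] E) (hT : Function.Injective T) (u v : K)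
    (hu : T u ∈ (rangeForm T hT).domain) (hv : T v ∈ (rangeForm T hT).domain) :
    (rangeForm T hT).form ⟨T u, hu⟩ ⟨T v, hv⟩ = ⟪u, v⟫_ℂ := by
  have key : ∀ (v : K) (hv : T v ∈ LinearMap.range T.toLinearMap),
      (LinearEquiv.ofInjective T.toLinearMap hT).symm ⟨T v, hv⟩ = v := fun v hv =>
    (LinearEquiv.symm_apply_eq _).2 (Subtype.ext (by simp))
  exact congrArg₂ (fun a b => ⟪a, b⟫_ℂ) (key u hu) (key v hv)

theorem cauchySeq_iff_tendsto_norm_sub_sq {K : Type*} [NormedAddCommGroup K] (v : ℕ → K) :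
    CauchySeq v ↔ Tendsto (fun mn : ℕ × ℕ => ‖v mn.1 - v mn.2‖ ^ 2) atTop (𝓝 0) := by
  rw [cauchySeq_iff_tendsto_dist_atTop_0]
  simp only [dist_eq_norm]
  constructor
  · intro h
    simpa using h.pow 2
  · intro h
    simpa [Real.sqrt_sq (norm_nonneg _)] using h.sqrt

theorem rangeForm_self (T : K →L[ℂ] E) (hT : Function.Injective T) (u : K)
    (hu : T u ∈ (rangeForm T hT).domain) :
    ((rangeForm T hT).form ⟨T u, hu⟩ ⟨T u, hu⟩).re = ‖u‖ ^ 2 := by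
  rw [rangeForm_apply, inner_self_eq_norm_sq_to_K]
  norm_cast

/-- The form norm of `T v` is the norm of `v`, so form-Cauchy sequences lift to Cauchy sequences in
the complete space `K`; continuity of `T` identifies the limit. -/
theorem rangeForm_isClosed [CompleteSpace K] (T : K →L[ℂ] E) (hT : Function.Injective T) :
    (rangeForm T hT).IsClosed := by
  rintro u x ⟨hx, hc⟩
  choose v hv using fun n => (u n).2
  have hv' : ∀ n, u n = ⟨T (v n), mem_rangeForm T hT _⟩ := fun n => Subtype.ext (hv n).symm
  have hd : ∀ a b : K, (⟨T a, mem_rangeForm T hT a⟩ - ⟨T b, mem_rangeForm T hT b⟩ :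
      (rangeForm T hT).domain) = ⟨T (a - b), mem_rangeForm T hT _⟩ := fun a b =>
    Subtype.ext (map_sub T a b).symm
  have hC : CauchySeq v := by
    rw [cauchySeq_iff_tendsto_norm_sub_sq]
    refine hc.congr fun mn => ?_
    simp only [hv', hd, rangeForm_self]
  obtain ⟨z, hz⟩ := cauchySeq_tendsto_of_complete hC
  have hTz : x = T z := by
    refine tendsto_nhds_unique (hx.congr fun n => ?_) ((T.continuous.tendsto z).comp hz)
    exact (hv n).symm
  subst hTz
  refine ⟨mem_rangeForm T hT z, ?_⟩
  have h0 : Tendsto (fun n => ‖v n - z‖ ^ 2) atTop (𝓝 0) := by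
    simpa using (tendsto_iff_norm_sub_tendsto_zero.1 hz).pow 2
  refine h0.congr fun n => ?_
  simp only [hv', hd, rangeForm_self]

section Closure

variable {D : Type*} [AddCommGroup D] [Module ℂ D]
  (ι : D →ₗ[ℂ] E) (A : D →ₗ[ℂ] K)

theorem formConverges_iff [CompleteSpace K] (u : ℕ → D) (x : E) :
    FormConverges ι (fun g => ‖A g‖ ^ 2) u x ↔
      Tendsto (fun n => ι (u n)) atTop (𝓝 x) ∧ ∃ v, Tendsto (fun n => A (u n)) atTop (𝓝 v) := by
  have : (∃ v, Tendsto (fun n => A (u n)) atTop (𝓝 v)) ↔ CauchySeq fun n => A (u n) :=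
    ⟨fun ⟨_, h⟩ => h.cauchySeq, cauchySeq_tendsto_of_complete⟩
  rw [this, cauchySeq_iff_tendsto_norm_sub_sq]
  simp only [FormConverges, map_sub]

variable {ι A}

/-- The hypothesis is closability of the operator `A`; being Cauchy for `‖A ·‖²` means that `A (u
n)` converges, and then its limit must vanish. -/
theorem isClosableForm_of [CompleteSpace K]
    (hcl : ∀ (u : ℕ → D) (v : K), Tendsto (fun n => ι (u n)) atTop (𝓝 0) →
      Tendsto (fun n => A (u n)) atTop (𝓝 v) → v = 0) :
    IsClosableForm ι fun g => ‖A g‖ ^ 2 := by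
  intro u hu
  obtain ⟨h0, v, hv⟩ := (formConverges_iff ι A u 0).1 hu
  rw [hcl u v h0 hv] at hv
  simpa using hv.norm.pow 2

theorem exists_seq_tendsto (hA : DenseRange A) (v : K) :
    ∃ u : ℕ → D, Tendsto (fun n => A (u n)) atTop (𝓝 v) := by
  obtain ⟨y, hy, hyv⟩ := mem_closure_iff_seq_limit.1 (hA v)
  choose u hu using hy
  exact ⟨u, by simpa only [hu] using hyv⟩

variable {T : K →L[ℂ] E}

/-- If `T v = 0` and `A (u n) → v`, then `ι (u n) = T (A (u n)) → 0`, so closability of `A` forces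
`v = 0`. -/
theorem injective_of_closable (hA : DenseRange A) (hTA : ∀ g, T (A g) = ι g)
    (hcl : ∀ (u : ℕ → D) (v : K), Tendsto (fun n => ι (u n)) atTop (𝓝 0) →
      Tendsto (fun n => A (u n)) atTop (𝓝 v) → v = 0) : Function.Injective T := by
  rw [injective_iff_map_eq_zero]
  intro v hv
  obtain ⟨u, hu⟩ := exists_seq_tendsto hA v
  refine hcl u v ?_ hu
  have := (T.continuous.tendsto v).comp hu
  rw [hv] at this
  exact this.congr fun n => hTA _

/-- The limits `x` of `ι (u n)` and `v` of `A (u n)` always satisfy `x = T v`, and density of the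
range of `A` makes every `v` occur. -/
theorem rangeForm_isClosureOf [CompleteSpace K] (hA : DenseRange A) (hTA : ∀ g, T (A g) = ι g)
    (hT : Function.Injective T) :
    (rangeForm T hT).IsClosureOf ι fun g => ‖A g‖ ^ 2 := by
  have key : ∀ (u : ℕ → D) (x : E) (v : K), Tendsto (fun n => ι (u n)) atTop (𝓝 x) →
      Tendsto (fun n => A (u n)) atTop (𝓝 v) → x = T v := fun u x v hx hv =>
    tendsto_nhds_unique hx (((T.continuous.tendsto v).comp hv).congr fun n => hTA _)
  constructor
  · intro x
    constructor
    · rintro ⟨v, rfl⟩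
      obtain ⟨u, hu⟩ := exists_seq_tendsto hA v
      exact ⟨u, (formConverges_iff ι A _ _).2
        ⟨((T.continuous.tendsto v).comp hu).congr fun n => hTA _, v, hu⟩⟩
    · rintro ⟨u, hu⟩
      obtain ⟨h0, v, hv⟩ := (formConverges_iff ι A _ _).1 hu
      exact ⟨v, (key u x v h0 hv).symm⟩
  · rintro ⟨x, hx⟩ u hu
    obtain ⟨h0, v, hv⟩ := (formConverges_iff ι A _ _).1 hu
    obtain rfl := key u x v h0 hv
    rw [rangeForm_apply, inner_self_eq_norm_sq_to_K]
    have := (hv.norm.pow 2).ofReal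
    simpa using this

end Closure

/-- The inverse of a bounded operator, given by its graph. -/
def inverseOp (G : E →L[ℂ] E) : E →ₗ.[ℂ] E :=
  ((LinearMap.graph G.toLinearMap).comap (LinearEquiv.prodComm ℂ E E).toLinearMap).toLinearPMap

theorem mem_inverseOp_graph {G : E →L[ℂ] E} (hG : Function.Injective G) (f k : E) :
    (f, k) ∈ (inverseOp G).graph ↔ f = G k := by
  rw [inverseOp, Submodule.toLinearPMap_graph_eq]
  · simp [LinearMap.mem_graph_iff]
  · rintro ⟨a, b⟩ hab h0
    simp only [Submodule.mem_comap, LinearEquiv.coe_coe, LinearEquiv.prodComm_apply,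
      Prod.swap_prod_mk, LinearMap.mem_graph_iff, ContinuousLinearMap.coe_coe] at hab h0
    subst h0
    exact (injective_iff_map_eq_zero G).1 hG b hab.symm

theorem dense_domain_inverseOp {G : E →L[ℂ] E} (hG : Function.Injective G) (hd : DenseRange G) :
    Dense ((inverseOp G).domain : Set E) := by
  refine hd.mono ?_
  rintro _ ⟨k, rfl⟩
  exact LinearPMap.mem_domain_of_mem_graph ((mem_inverseOp_graph hG (G k) k).2 rfl)

/-- By symmetry the orthogonal complement of the range of `G` is its kernel, so the domain is dense.
The adjoint graph is then found by testing against the pairs `(G b, b)` with `b` arbitrary. -/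
theorem isSelfAdjoint_inverseOp [CompleteSpace E] {G : E →L[ℂ] E} (hG : Function.Injective G)
    (hsym : ∀ x y, ⟪G x, y⟫_ℂ = ⟪x, G y⟫_ℂ) : IsSelfAdjoint (inverseOp G) := by
  have hd : DenseRange G := by
    have : (LinearMap.range G.toLinearMap).topologicalClosure = ⊤ := by
      rw [Submodule.topologicalClosure_eq_top_iff, Submodule.eq_bot_iff]
      intro y hy
      refine (injective_iff_map_eq_zero G).1 hG y ?_
      refine ext_inner_left ℂ fun x => ?_
      rw [inner_zero_right, ← hsym]
      exact hy (G x) ⟨x, rfl⟩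
    intro y
    have h : y ∈ (LinearMap.range G.toLinearMap).topologicalClosure := this ▸ Submodule.mem_top
    simpa using! h
  rw [LinearPMap.isSelfAdjoint_def]
  refine LinearPMap.eq_of_eq_graph ?_
  rw [LinearPMap.adjoint_graph_eq_graph_adjoint (dense_domain_inverseOp hG hd)]
  ext ⟨f, k⟩
  rw [Submodule.mem_adjoint_iff, mem_inverseOp_graph hG]
  constructor
  · intro h
    refine ext_inner_left ℂ fun b => ?_
    have := h (G b) b ((mem_inverseOp_graph hG _ _).2 rfl)
    rw [← hsym]
    exact sub_eq_zero.1 this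
  · rintro rfl a b hab
    rw [(mem_inverseOp_graph hG _ _).1 hab, hsym, sub_self]

theorem isClosed_inverseOp_graph {G : E →L[ℂ] E} (hG : Function.Injective G) :
    IsClosed ((inverseOp G).graph : Set (E × E)) := by
  have : ((inverseOp G).graph : Set (E × E)) = {P | P.1 = G P.2} := by
    ext ⟨f, k⟩
    exact mem_inverseOp_graph hG f k
  rw [this]
  exact isClosed_eq continuous_fst (G.continuous.comp continuous_snd)

/-- A part of the inverse of a bounded operator with dense range is a core. -/
theorem inverseOp_graph_eq_closure {G : E →L[ℂ] E} (hG : Function.Injective G) {S : Set (E × E)}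
    (hS : S ⊆ (inverseOp G).graph) (hd : Dense (Prod.snd '' S)) :
    closure S = (inverseOp G).graph := by
  refine (closure_minimal hS (isClosed_inverseOp_graph hG)).antisymm ?_
  rintro ⟨f, k⟩ hfk
  rw [SetLike.mem_coe, mem_inverseOp_graph hG] at hfk
  subst hfk
  -- The graph is the continuous image of its second components, so density of those components in
  -- `E` becomes density of `S` in the graph.
  have hc : Continuous fun k : E => (G k, k) := by fun_prop
  have : (fun k : E => (G k, k)) '' (Prod.snd '' S) ⊆ S := by
    rintro _ ⟨_, ⟨⟨a, b⟩, hab, rfl⟩, rfl⟩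
    have := (mem_inverseOp_graph hG _ _).1 (hS hab)
    rwa [this] at hab
  exact closure_mono this (image_closure_subset_closure_image hc ⟨k, hd k, rfl⟩)

variable [CompleteSpace E] [CompleteSpace K]

/-- The operator `(T T†)⁻¹`. -/
def formOperator (T : K →L[ℂ] E) : E →ₗ.[ℂ] E := inverseOp (T ∘L ContinuousLinearMap.adjoint T)

theorem injective_comp_adjoint {T : K →L[ℂ] E} (hT : Function.Injective T) (hr : DenseRange T) :
    Function.Injective (T ∘L ContinuousLinearMap.adjoint T) := by
  refine hT.comp ((injective_iff_map_eq_zero _).2 fun y hy => ?_)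
  have hy' : ContinuousLinearMap.adjoint T y = 0 := hy
  refine hr.eq_zero_of_inner_left ℂ fun v => ?_
  rw [← ContinuousLinearMap.adjoint_inner_left, hy', inner_zero_left]

theorem isSelfAdjoint_formOperator {T : K →L[ℂ] E} (hT : Function.Injective T)
    (hr : DenseRange T) : IsSelfAdjoint (formOperator T) := by
  refine isSelfAdjoint_inverseOp (injective_comp_adjoint hT hr) fun x y => ?_
  rw [ContinuousLinearMap.comp_apply, ContinuousLinearMap.comp_apply,
    ← ContinuousLinearMap.adjoint_inner_right, ContinuousLinearMap.adjoint_inner_left]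

/-- For `f = T v` the weak equation reads `⟪g, v⟫ = ⟪T g, k⟫` for all `g`, that is `v = T† k` and `f
= T T† k`. -/
theorem rangeForm_isAssociated {T : K →L[ℂ] E} (hT : Function.Injective T) (hr : DenseRange T) :
    (rangeForm T hT).IsAssociated (formOperator T) := by
  intro f k
  rw [formOperator, mem_inverseOp_graph (injective_comp_adjoint hT hr)]
  constructor
  · rintro rfl
    refine ⟨⟨_, rfl⟩, ?_⟩
    rintro ⟨_, v, rfl⟩
    refine (rangeForm_apply T hT v (ContinuousLinearMap.adjoint T k) ⟨_, rfl⟩ ⟨_, rfl⟩).trans ?_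
    exact ContinuousLinearMap.adjoint_inner_right T v k
  · rintro ⟨⟨v, rfl⟩, h⟩
    have : v = ContinuousLinearMap.adjoint T k := by
      refine ext_inner_left ℂ fun g => ?_
      rw [ContinuousLinearMap.adjoint_inner_right]
      exact (rangeForm_apply T hT g v ⟨_, rfl⟩ ⟨_, rfl⟩).symm.trans (h ⟨T g, ⟨g, rfl⟩⟩)
    rw [this]
    rfl

/-- The weak equation need only be tested on the dense range of `A`. This is the criterion later
applied to the cutoff approximations of transformed functions. -/
theorem mem_formOperator_graph_of_tendsto {D : Type*} [AddCommGroup D] [Module ℂ D]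
    {ι : D →ₗ[ℂ] E} {A : D →ₗ[ℂ] K} {T : K →L[ℂ] E} (hA : DenseRange A)
    (hTA : ∀ g, T (A g) = ι g) (hT : Function.Injective T) (hr : DenseRange T)
    {f k : E} {v : K} {u : ℕ → D} (hf : Tendsto (fun n => ι (u n)) atTop (𝓝 f))
    (hv : Tendsto (fun n => A (u n)) atTop (𝓝 v)) (hk : ∀ g, ⟪A g, v⟫_ℂ = ⟪ι g, k⟫_ℂ) :
    (f, k) ∈ (formOperator T).graph := by
  rw [formOperator, mem_inverseOp_graph (injective_comp_adjoint hT hr)]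
  have h1 : f = T v :=
    tendsto_nhds_unique hf (((T.continuous.tendsto v).comp hv).congr fun n => hTA _)
  have h2 : v = ContinuousLinearMap.adjoint T k := by
    refine hA.eq_of_inner_right ℂ fun g => ?_
    rw [ContinuousLinearMap.adjoint_inner_right, hTA, hk]
  rw [h1, h2]
  rfl

end AbstractForm

/-! ### The change of variables -/

/-- `√(p / w)` -/
def rho (x : ℝ) : ℝ := Real.sqrt (x * (1 - x) * (x + 1))

theorem cubic_pos {x : ℝ} (hx : x ∈ Ioo (0 : ℝ) 1) : 0 < x * (1 - x) * (x + 1) := by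
  have h1 : 0 < 1 - x := by linarith [hx.2]
  have h2 : 0 < x + 1 := by linarith [hx.1]
  have h3 := hx.1
  positivity

theorem rho_pos {x : ℝ} (hx : x ∈ Ioo (0 : ℝ) 1) : 0 < rho x := Real.sqrt_pos.2 (cubic_pos hx)

theorem rho_sq {x : ℝ} (hx : x ∈ Ioo (0 : ℝ) 1) : rho x ^ 2 = x * (1 - x) * (x + 1) :=
  Real.sq_sqrt (cubic_pos hx).le

theorem rho_le_one {x : ℝ} (hx : x ∈ Ioo (0 : ℝ) 1) : rho x ≤ 1 := by
  rw [rho, Real.sqrt_le_one]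
  nlinarith [hx.1, hx.2, mul_pos hx.1 (sub_pos.2 hx.2), mul_pos hx.1 hx.1]

theorem contDiffOn_rho : ContDiffOn ℝ ∞ rho (Ioo 0 1) :=
  ContDiffOn.sqrt (by fun_prop) fun _ hx => (cubic_pos hx).ne'

theorem hasDerivAt_rho {x : ℝ} (hx : x ∈ Ioo (0 : ℝ) 1) :
    HasDerivAt rho ((1 - 3 * x ^ 2) / (2 * rho x)) x := by
  have h : HasDerivAt (fun x : ℝ => x * (1 - x) * (x + 1)) (1 - 3 * x ^ 2) x := by
    refine (((hasDerivAt_id x).mul ((hasDerivAt_id x).const_sub 1)).mul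
      ((hasDerivAt_id x).add_const 1)).congr_deriv ?_
    simp only [id, Pi.mul_apply]
    ring
  exact h.sqrt (cubic_pos hx).ne'

theorem sqrt_w_div_p (ε : ℝ) {x : ℝ} (hx : x ∈ Ioo (0 : ℝ) 1) :
    Real.sqrt (w ε x / p ε x) = (rho x)⁻¹ := by
  have hw := (w_pos ε hx).ne'
  have hc := (cubic_pos hx).ne'
  rw [rho, ← Real.sqrt_inv, p_eq ε hx]
  congr 1
  field_simp

/-- The cubic under the root has simple zeros at `0` and `1`, so `1/ρ` has only integrable inverse
square root singularities; this gives `β < ∞`. -/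
theorem inv_rho_le {x : ℝ} (hx : x ∈ Ioo (0 : ℝ) 1) :
    (rho x)⁻¹ ≤ 2 * (x ^ (-(1 / 2) : ℝ) + (1 - x) ^ (-(1 / 2) : ℝ)) := by
  have h1 : 0 < 1 - x := by linarith [hx.2]
  have h0 := hx.1
  rw [Real.rpow_neg h0.le, Real.rpow_neg h1.le, ← Real.sqrt_eq_rpow, ← Real.sqrt_eq_rpow]
  have key : ∀ y : ℝ, 0 < y → y / 4 ≤ x * (1 - x) * (x + 1) → (rho x)⁻¹ ≤ 2 * (Real.sqrt y)⁻¹ := by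
    intro y hy hle
    have hs : 0 < Real.sqrt y := Real.sqrt_pos.2 hy
    have : Real.sqrt y / 2 ≤ rho x := by
      refine Real.le_sqrt_of_sq_le ?_
      rw [div_pow, Real.sq_sqrt hy.le]
      linarith
    calc (rho x)⁻¹ ≤ (Real.sqrt y / 2)⁻¹ := inv_anti₀ (by positivity) this
      _ = 2 * (Real.sqrt y)⁻¹ := by rw [inv_div, div_eq_mul_inv]
  have p0 : 0 ≤ (Real.sqrt x)⁻¹ := by positivity
  have p1 : 0 ≤ (Real.sqrt (1 - x))⁻¹ := by positivity
  rcases le_total x (1 / 2) with h | h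
  · have := key x h0 (by nlinarith [mul_pos h0 h1])
    linarith
  · have := key (1 - x) h1 (by nlinarith [mul_pos h0 h1])
    linarith

theorem intervalIntegrable_rpow_one_sub {r : ℝ} (hr : -1 < r) :
    IntervalIntegrable (fun x : ℝ => (1 - x) ^ r) volume 0 1 := by
  simpa using (intervalIntegral.intervalIntegrable_rpow' (a := 1) (b := 0) hr).comp_sub_left 1

theorem intervalIntegrable_sqrt (ε : ℝ) :
    IntervalIntegrable (fun y => Real.sqrt (w ε y / p ε y)) volume 0 1 := by
  have hg : IntervalIntegrable
      (fun x : ℝ => 2 * (x ^ (-(1 / 2) : ℝ) + (1 - x) ^ (-(1 / 2) : ℝ))) volume 0 1 :=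
    ((intervalIntegral.intervalIntegrable_rpow' (by norm_num)).add
      (intervalIntegrable_rpow_one_sub (by norm_num))).const_mul 2
  refine hg.mono_fun ?_ ?_
  · refine Measurable.aestronglyMeasurable ?_
    have := measurable_w ε
    unfold p
    fun_prop
  · rw [uIoc_of_le zero_le_one, ← restrict_Ioo_eq_restrict_Ioc]
    filter_upwards [ae_restrict_mem measurableSet_Ioo] with x hx
    rw [sqrt_w_div_p ε hx, Real.norm_of_nonneg (inv_nonneg.2 (rho_pos hx).le)]
    exact (inv_rho_le hx).trans (le_abs_self _)

theorem continuousOn_psi (ε : ℝ) : ContinuousOn (psi ε) (Icc 0 1) := by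
  have := intervalIntegral.continuousOn_primitive_interval
    (intervalIntegrable_iff_integrableOn_Icc_of_le zero_le_one |>.1 (intervalIntegrable_sqrt ε)
      |> fun h => (uIcc_of_le (zero_le_one' ℝ)).symm ▸ h)
  rwa [uIcc_of_le zero_le_one] at this

theorem continuousAt_sqrt (ε : ℝ) {x : ℝ} (hx : x ∈ Ioo (0 : ℝ) 1) :
    ContinuousAt (fun y => Real.sqrt (w ε y / p ε y)) x := by
  have h : ContinuousAt (fun y => (rho y)⁻¹) x :=
    (hasDerivAt_rho hx).continuousAt.inv₀ (rho_pos hx).ne'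
  exact h.congr (eventually_of_mem (isOpen_Ioo.mem_nhds hx) fun y hy => (sqrt_w_div_p ε hy).symm)

theorem hasDerivAt_psi (ε : ℝ) {x : ℝ} (hx : x ∈ Ioo (0 : ℝ) 1) :
    HasDerivAt (psi ε) (rho x)⁻¹ x := by
  rw [← sqrt_w_div_p ε hx]
  refine intervalIntegral.integral_hasDerivAt_right
    ((intervalIntegrable_sqrt ε).mono_set ?_) ?_ (continuousAt_sqrt ε hx)
  · rw [uIcc_of_le hx.1.le, uIcc_of_le zero_le_one]
    exact Icc_subset_Icc_right hx.2.le
  · refine (Measurable.stronglyMeasurable ?_).stronglyMeasurableAtFilter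
    have := measurable_w ε
    unfold p
    fun_prop

theorem strictMonoOn_psi (ε : ℝ) : StrictMonoOn (psi ε) (Icc 0 1) := by
  refine strictMonoOn_of_deriv_pos (convex_Icc 0 1) (continuousOn_psi ε) fun x hx => ?_
  rw [interior_Icc] at hx
  rw [(hasDerivAt_psi ε hx).deriv]
  exact inv_pos.2 (rho_pos hx)

theorem psi_zero (ε : ℝ) : psi ε 0 = 0 := intervalIntegral.integral_same

theorem beta_pos (ε : ℝ) : 0 < beta ε := by
  have := strictMonoOn_psi ε (left_mem_Icc.2 zero_le_one) (right_mem_Icc.2 zero_le_one) zero_lt_one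
  rwa [psi_zero] at this

theorem bijOn_psi (ε : ℝ) : BijOn (psi ε) (Icc 0 1) (Icc 0 (beta ε)) := by
  refine ⟨fun x hx => ?_, (strictMonoOn_psi ε).injOn, ?_⟩
  · have m := (strictMonoOn_psi ε).monotoneOn
    constructor
    · rw [← psi_zero ε]
      exact m (left_mem_Icc.2 zero_le_one) hx hx.1
    · exact m hx (right_mem_Icc.2 zero_le_one) hx.2
  · have := intermediate_value_Icc zero_le_one (continuousOn_psi ε)
    rwa [psi_zero] at this

theorem invOn_phi (ε : ℝ) : InvOn (phi ε) (psi ε) (Icc 0 1) (Icc 0 (beta ε)) :=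
  (bijOn_psi ε).invOn_invFunOn

theorem phi_mem_Icc (ε : ℝ) {s : ℝ} (hs : s ∈ Icc 0 (beta ε)) : phi ε s ∈ Icc (0 : ℝ) 1 :=
  (bijOn_psi ε).surjOn.mapsTo_invFunOn hs

theorem psi_phi (ε : ℝ) {s : ℝ} (hs : s ∈ Icc 0 (beta ε)) : psi ε (phi ε s) = s :=
  (invOn_phi ε).2 hs

theorem phi_psi (ε : ℝ) {x : ℝ} (hx : x ∈ Icc (0 : ℝ) 1) : phi ε (psi ε x) = x :=
  (invOn_phi ε).1 hx

theorem strictMonoOn_phi (ε : ℝ) : StrictMonoOn (phi ε) (Icc 0 (beta ε)) := by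
  intro s hs t ht hst
  rw [← (strictMonoOn_psi ε).lt_iff_lt (phi_mem_Icc ε hs) (phi_mem_Icc ε ht), psi_phi ε hs,
    psi_phi ε ht]
  exact hst

theorem phi_zero (ε : ℝ) : phi ε 0 = 0 := by
  have := phi_psi ε (left_mem_Icc.2 zero_le_one)
  rwa [psi_zero] at this

theorem phi_beta (ε : ℝ) : phi ε (beta ε) = 1 := phi_psi ε (right_mem_Icc.2 zero_le_one)

theorem phi_mem (ε : ℝ) {s : ℝ} (hs : s ∈ Ioo 0 (beta ε)) : phi ε s ∈ Ioo (0 : ℝ) 1 := by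
  have m := strictMonoOn_phi ε
  have hs' := Ioo_subset_Icc_self hs
  constructor
  · have := m (left_mem_Icc.2 (beta_pos ε).le) hs' hs.1
    rwa [phi_zero] at this
  · have := m hs' (right_mem_Icc.2 (beta_pos ε).le) hs.2
    rwa [phi_beta] at this

theorem psi_mem (ε : ℝ) {x : ℝ} (hx : x ∈ Ioo (0 : ℝ) 1) : psi ε x ∈ Ioo 0 (beta ε) := by
  have m := strictMonoOn_psi ε
  have hx' := Ioo_subset_Icc_self hx
  constructor
  · have := m (left_mem_Icc.2 zero_le_one) hx' hx.1
    rwa [psi_zero] at this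
  · exact m hx' (right_mem_Icc.2 zero_le_one) hx.2

theorem image_phi (ε : ℝ) : phi ε '' Ioo 0 (beta ε) = Ioo 0 1 :=
  (Set.mapsTo_iff_image_subset.1 fun _ hs => phi_mem ε hs).antisymm fun x hx =>
    ⟨psi ε x, psi_mem ε hx, phi_psi ε (Ioo_subset_Icc_self hx)⟩

theorem image_psi (ε : ℝ) : psi ε '' Ioo 0 1 = Ioo 0 (beta ε) :=
  (Set.mapsTo_iff_image_subset.1 fun _ hs => psi_mem ε hs).antisymm fun s hs =>
    ⟨phi ε s, phi_mem ε hs, psi_phi ε (Ioo_subset_Icc_self hs)⟩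

/-- The inverse of a continuous bijection of compact intervals: the preimage of a closed set under
`φ` is the image of a compact set under `ψ`. -/
theorem continuousOn_phi (ε : ℝ) : ContinuousOn (phi ε) (Icc 0 (beta ε)) := by
  refine continuousOn_iff_isClosed.2 fun t ht => ⟨psi ε '' (t ∩ Icc 0 1), ?_, ?_⟩
  · exact ((isCompact_Icc.inter_left ht).image_of_continuousOn
      ((continuousOn_psi ε).mono inter_subset_right)).isClosed
  · ext s
    constructor
    · rintro ⟨h1, h2⟩
      exact ⟨⟨phi ε s, ⟨h1, phi_mem_Icc ε h2⟩, psi_phi ε h2⟩, h2⟩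
    · rintro ⟨⟨x, ⟨h1, h2⟩, rfl⟩, h3⟩
      refine ⟨?_, h3⟩
      rwa [mem_preimage, phi_psi ε h2]

theorem hasDerivAt_phi (ε : ℝ) {s : ℝ} (hs : s ∈ Ioo 0 (beta ε)) :
    HasDerivAt (phi ε) (rho (phi ε s)) s := by
  have h := HasDerivAt.of_local_left_inverse (f := psi ε) (g := phi ε) (a := s)
    ((continuousOn_phi ε).continuousAt (Icc_mem_nhds hs.1 hs.2)) (hasDerivAt_psi ε (phi_mem ε hs))
    (inv_ne_zero (rho_pos (phi_mem ε hs)).ne')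
    (eventually_of_mem (isOpen_Ioo.mem_nhds hs) fun t ht => psi_phi ε (Ioo_subset_Icc_self ht))
  rwa [inv_inv] at h

/-- Bootstrapping along the autonomous equation `φ' = ρ ∘ φ` with `ρ` smooth on `(0, 1)`. -/
theorem contDiffOn_phi (ε : ℝ) : ContDiffOn ℝ ∞ (phi ε) (Ioo 0 (beta ε)) := by
  have hd : DifferentiableOn ℝ (phi ε) (Ioo 0 (beta ε)) := fun s hs =>
    (hasDerivAt_phi ε hs).differentiableAt.differentiableWithinAt
  refine contDiffOn_infty.2 fun n => ?_
  induction n with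
  | zero => exact contDiffOn_zero.2 hd.continuousOn
  | succ n ih =>
    rw [Nat.cast_succ, contDiffOn_succ_iff_deriv_of_isOpen isOpen_Ioo]
    refine ⟨hd, by simp, ?_⟩
    refine ((contDiffOn_rho.of_le (by exact_mod_cast le_top)).comp ih
      fun s hs => phi_mem ε hs).congr fun s hs => (hasDerivAt_phi ε hs).deriv

theorem tendsto_phi_zero (ε : ℝ) : Tendsto (phi ε) (𝓝[>] 0) (𝓝 0) := by
  have h := continuousOn_phi ε 0 (left_mem_Icc.2 (beta_pos ε).le)
  rw [ContinuousWithinAt, phi_zero] at h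
  exact h.mono_left (nhdsWithin_le_of_mem (Icc_mem_nhdsGT (beta_pos ε)))

theorem tendsto_phi_beta (ε : ℝ) : Tendsto (phi ε) (𝓝[<] (beta ε)) (𝓝 1) := by
  have h := continuousOn_phi ε (beta ε) (right_mem_Icc.2 (beta_pos ε).le)
  rw [ContinuousWithinAt, phi_beta] at h
  exact h.mono_left (nhdsWithin_le_of_mem (Icc_mem_nhdsLT (beta_pos ε)))

/-! ### The coefficients in the new variable -/

theorem p_eq_rho_sq (ε : ℝ) {x : ℝ} (hx : x ∈ Ioo (0 : ℝ) 1) : p ε x = rho x ^ 2 * w ε x := by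
  rw [rho_sq hx, p_eq ε hx]

theorem contDiffOn_w (ε : ℝ) : ContDiffOn ℝ ∞ (w ε) (Ioo 0 1) := by
  unfold w
  refine (ContDiffOn.mul (contDiffOn_id.inv fun x hx => hx.1.ne')
    (ContDiffOn.rpow_const_of_ne (by fun_prop) fun x hx => ?_)).mul
      (ContDiffOn.rpow_const_of_ne (by fun_prop) fun x hx => ?_)
  · linarith [hx.2]
  · linarith [hx.1]

theorem contDiffOn_p (ε : ℝ) : ContDiffOn ℝ ∞ (p ε) (Ioo (-1) 1) := by
  unfold p
  refine (ContDiffOn.rpow_const_of_ne (by fun_prop) fun x hx => ?_).mul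
      (ContDiffOn.rpow_const_of_ne (by fun_prop) fun x hx => ?_)
  · linarith [hx.2]
  · linarith [hx.1]

theorem p_pos (ε : ℝ) {x : ℝ} (hx : x ∈ Ioo (-1 : ℝ) 1) : 0 < p ε x := by
  have h1 : 0 < 1 - x := by linarith [hx.2]
  have h2 : 0 < x + 1 := by linarith [hx.1]
  unfold p
  positivity

/-- `(w p)^{1/4}` -/
def amp (ε x : ℝ) : ℝ := Real.sqrt (rho x * w ε x)

theorem rho_mul_w_pos (ε : ℝ) {x : ℝ} (hx : x ∈ Ioo (0 : ℝ) 1) : 0 < rho x * w ε x :=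
  mul_pos (rho_pos hx) (w_pos ε hx)

theorem amp_pos (ε : ℝ) {x : ℝ} (hx : x ∈ Ioo (0 : ℝ) 1) : 0 < amp ε x :=
  Real.sqrt_pos.2 (rho_mul_w_pos ε hx)

theorem amp_sq (ε : ℝ) {x : ℝ} (hx : x ∈ Ioo (0 : ℝ) 1) : amp ε x ^ 2 = rho x * w ε x :=
  Real.sq_sqrt (rho_mul_w_pos ε hx).le

theorem contDiffOn_amp (ε : ℝ) : ContDiffOn ℝ ∞ (amp ε) (Ioo 0 1) :=
  ContDiffOn.sqrt (contDiffOn_rho.mul (contDiffOn_w ε)) fun _ hx => (rho_mul_w_pos ε hx).ne'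

theorem c_eq (ε : ℝ) {s : ℝ} (hs : s ∈ Ioo 0 (beta ε)) : c ε s = (amp ε (phi ε s))⁻¹ := by
  have hx := phi_mem ε hs
  have h : w ε (phi ε s) * p ε (phi ε s) = amp ε (phi ε s) ^ (4 : ℝ) := by
    rw [p_eq_rho_sq ε hx, show (4 : ℝ) = ((4 : ℕ) : ℝ) by norm_num, Real.rpow_natCast,
      show amp ε (phi ε s) ^ 4 = (amp ε (phi ε s) ^ 2) ^ 2 by ring, amp_sq ε hx]
    ring
  rw [c, h, ← Real.rpow_mul (amp_pos ε hx).le, ← Real.rpow_neg_one]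
  norm_num

theorem hasDerivAt_w (ε : ℝ) {x : ℝ} (hx : x ∈ Ioo (0 : ℝ) 1) :
    HasDerivAt (w ε) (-((1 + 2 * x / ε - x ^ 2) * w ε x / rho x ^ 2)) x := by
  have h : HasDerivAt (fun x : ℝ => rho x ^ 2) (1 - 3 * x ^ 2) x := by
    refine ((hasDerivAt_rho hx).pow 2).congr_deriv ?_
    have := (rho_pos hx).ne'
    field_simp
    norm_num
    ring
  have hr := (rho_pos hx).ne'
  -- Writing `w = p/ρ²` reuses the derivative of `p`.
  have h2 := (hasDerivAt_p ε hx).div h (pow_ne_zero 2 hr)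
  have h3 : HasDerivAt (w ε) _ x := h2.congr_of_eventuallyEq
    (eventually_of_mem (isOpen_Ioo.mem_nhds hx) fun y hy => ?_)
  · refine h3.congr_deriv ?_
    rw [p_eq_rho_sq ε hx]
    have h1 : 0 < 1 - x := by linarith [hx.2]
    have h2 : 0 < x + 1 := by linarith [hx.1]
    have h0 := hx.1.ne'
    rw [rho_sq hx]
    field_simp
    ring
  · have := (rho_pos hy).ne'
    simp only [Pi.div_apply]
    rw [p_eq_rho_sq ε hy]
    field_simp

/-- the logarithmic derivative of `(w p)^{1/4} ∘ φ`, as a function of `x = φ(s)` -/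
def logDer (ε x : ℝ) : ℝ := -((1 + x ^ 2 + 4 * x / ε) / (4 * rho x))

theorem hasDerivAt_amp (ε : ℝ) {x : ℝ} (hx : x ∈ Ioo (0 : ℝ) 1) :
    HasDerivAt (amp ε) (logDer ε x * amp ε x / rho x) x := by
  have h := ((hasDerivAt_rho hx).mul (hasDerivAt_w ε hx)).sqrt (rho_mul_w_pos ε hx).ne'
  refine h.congr_deriv ?_
  change _ / (2 * amp ε x) = _
  have ha := (amp_pos ε hx).ne'
  have hr := (rho_pos hx).ne'
  rw [div_eq_div_iff (by positivity) hr]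
  rw [show logDer ε x * amp ε x * (2 * amp ε x) = 2 * logDer ε x * amp ε x ^ 2 by ring,
    amp_sq ε hx, logDer]
  field_simp
  ring

/-- the logarithmic derivative `θ = a' / a` of `a = c⁻¹` -/
def theta (ε s : ℝ) : ℝ := logDer ε (phi ε s)

theorem contDiffOn_logDer (ε : ℝ) : ContDiffOn ℝ ∞ (logDer ε) (Ioo 0 1) :=
  ((by fun_prop : ContDiffOn ℝ ∞ (fun x : ℝ => 1 + x ^ 2 + 4 * x / ε) (Ioo 0 1)).div
    (contDiffOn_const.mul contDiffOn_rho) fun x hx => by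
      have := (rho_pos hx).ne'
      positivity).neg

theorem contDiffOn_theta (ε : ℝ) : ContDiffOn ℝ ∞ (theta ε) (Ioo 0 (beta ε)) :=
  (contDiffOn_logDer ε).comp (contDiffOn_phi ε) fun _ hs => phi_mem ε hs

theorem hasDerivAt_amp_phi (ε : ℝ) {s : ℝ} (hs : s ∈ Ioo 0 (beta ε)) :
    HasDerivAt (fun s => amp ε (phi ε s)) (theta ε s * amp ε (phi ε s)) s := by
  refine ((hasDerivAt_amp ε (phi_mem ε hs)).comp s (hasDerivAt_phi ε hs)).congr_deriv ?_
  have hr := (rho_pos (phi_mem ε hs)).ne'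
  rw [theta]
  field_simp

theorem contDiffOn_c (ε : ℝ) : ContDiffOn ℝ ∞ (c ε) (Ioo 0 (beta ε)) :=
  (((contDiffOn_amp ε).comp (contDiffOn_phi ε) fun _ hs => phi_mem ε hs).inv
    fun _ hs => (amp_pos ε (phi_mem ε hs)).ne').congr fun _ hs => c_eq ε hs

theorem hasDerivAt_c (ε : ℝ) {s : ℝ} (hs : s ∈ Ioo 0 (beta ε)) :
    HasDerivAt (c ε) (-(theta ε s * c ε s)) s := by
  have ha := (amp_pos ε (phi_mem ε hs)).ne'
  have h := ((hasDerivAt_amp_phi ε hs).inv ha).congr_of_eventuallyEq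
    (eventually_of_mem (isOpen_Ioo.mem_nhds hs) fun t ht => c_eq ε ht)
  refine h.congr_deriv ?_
  rw [c_eq ε hs]
  field_simp

/-- the derivative of `theta` -/
def thetaDer (ε x : ℝ) : ℝ :=
  -(x + 2 / ε) / 2 + (1 + x ^ 2 + 4 * x / ε) * (1 - 3 * x ^ 2) / (8 * (x * (1 - x) * (x + 1)))

theorem hasDerivAt_theta (ε : ℝ) {s : ℝ} (hs : s ∈ Ioo 0 (beta ε)) :
    HasDerivAt (theta ε) (thetaDer ε (phi ε s)) s := by
  have hx := phi_mem ε hs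
  have hr := (rho_pos hx).ne'
  have h1 : ∀ x, HasDerivAt (fun x : ℝ => 1 + x ^ 2 + 4 * x / ε) (2 * x + 4 / ε) x := fun x => by
    refine ((((hasDerivAt_id x).pow 2).const_add 1).add
      (((hasDerivAt_id x).const_mul 4).div_const ε)).congr_deriv ?_
    simp
  have h2 := ((h1 _).div ((hasDerivAt_rho hx).const_mul 4) (by positivity)).neg
  refine (h2.comp s (hasDerivAt_phi ε hs)).congr_deriv ?_
  rw [thetaDer, ← rho_sq hx]
  field_simp
  ring

/-- With `a = 1/c` one has `(p ∘ φ)/φ' = a²` and `c' a² = -a'`, so `V = -c (c' a²)' = a''/a`. This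
Riccati form makes the Schrödinger form a square. -/
theorem V_eq (ε : ℝ) {s : ℝ} (hs : s ∈ Ioo 0 (beta ε)) :
    V ε s = thetaDer ε (phi ε s) + theta ε s ^ 2 := by
  have hn := isOpen_Ioo.mem_nhds hs
  have hc : c ε s ≠ 0 := by
    rw [c_eq ε hs]
    exact inv_ne_zero (amp_pos ε (phi_mem ε hs)).ne'
  have e1 : deriv (c ε) =ᶠ[𝓝 s] fun t => -(theta ε t * c ε t) :=
    eventually_of_mem hn fun t ht => (hasDerivAt_c ε ht).deriv
  have e2 : deriv (deriv (c ε)) s = -(thetaDer ε (phi ε s) * c ε s) + theta ε s ^ 2 * c ε s := by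
    rw [e1.deriv_eq, (((hasDerivAt_theta ε hs).fun_mul (hasDerivAt_c ε hs)).fun_neg).deriv]
    ring
  have e3 : (fun r => p ε (phi ε r) / deriv (phi ε) r) =ᶠ[𝓝 s] fun t => amp ε (phi ε t) ^ 2 := by
    refine eventually_of_mem hn fun t ht => ?_
    have hx := phi_mem ε ht
    have hr := (rho_pos hx).ne'
    simp only [(hasDerivAt_phi ε ht).deriv]
    rw [p_eq_rho_sq ε hx, amp_sq ε hx]
    field_simp
  have e4 : deriv (fun r => p ε (phi ε r) / deriv (phi ε) r) s =
      2 * theta ε s * amp ε (phi ε s) ^ 2 := by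
    rw [e3.deriv_eq, ((hasDerivAt_amp_phi ε hs).fun_pow 2).deriv]
    push_cast
    ring
  have e5 : p ε (phi ε s) / deriv (phi ε) s = amp ε (phi ε s) ^ 2 := e3.self_of_nhds
  rw [V, e4, e2, e1.self_of_nhds, e5]
  have ha : amp ε (phi ε s) = (c ε s)⁻¹ := by rw [c_eq ε hs, inv_inv]
  rw [ha]
  field_simp
  ring

theorem V_eq_explicit (ε : ℝ) {s : ℝ} (hs : s ∈ Ioo 0 (beta ε)) :
    V ε s = -(phi ε s + 2 / ε) / 2 + (1 + phi ε s ^ 2 + 4 * phi ε s / ε) *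
      (3 - 5 * phi ε s ^ 2 + 4 * phi ε s / ε) /
        (16 * (phi ε s * (1 - phi ε s) * (phi ε s + 1))) := by
  have hx := phi_mem ε hs
  have hr := (rho_pos hx).ne'
  rw [V_eq ε hs, thetaDer, theta, logDer, ← rho_sq hx]
  field_simp
  ring

theorem contDiffOn_V (ε : ℝ) : ContDiffOn ℝ ∞ (V ε) (Ioo 0 (beta ε)) := by
  have h : ContDiffOn ℝ ∞ (fun x : ℝ => -(x + 2 / ε) / 2 + (1 + x ^ 2 + 4 * x / ε) *
      (3 - 5 * x ^ 2 + 4 * x / ε) / (16 * (x * (1 - x) * (x + 1)))) (Ioo 0 1) := by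
    refine ContDiffOn.add (by fun_prop) (ContDiffOn.div (by fun_prop) (by fun_prop) fun x hx => ?_)
    have := (cubic_pos hx).ne'
    positivity
  exact (h.comp (contDiffOn_phi ε) fun _ hs => phi_mem ε hs).congr fun s hs => V_eq_explicit ε hs

/-! ### Asymptotics of the potential -/

/-- The factor `√φ` of `φ' = ρ(φ)` cancels in `(√φ)' = √((1 - φ)(1 + φ))/2`, which has limit `1/2`.
-/
theorem tendsto_sqrt_phi_div (ε : ℝ) :
    Tendsto (fun s => Real.sqrt (phi ε s) / s) (𝓝[>] 0) (𝓝 (1 / 2)) := by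
  have hmem : ∀ᶠ s in 𝓝[>] (0 : ℝ), s ∈ Ioo 0 (beta ε) := Ioo_mem_nhdsGT (beta_pos ε)
  refine HasDerivAt.lhopital_zero_nhdsGT
    (f' := fun s => Real.sqrt ((1 - phi ε s) * (phi ε s + 1)) / 2) (g' := fun _ => 1)
    (hmem.mono fun s hs => ?_) (Eventually.of_forall fun s => hasDerivAt_id s)
    (Eventually.of_forall fun _ => one_ne_zero) ?_ (tendsto_id.mono_left nhdsWithin_le_nhds) ?_
  · have hx := phi_mem ε hs
    refine ((hasDerivAt_phi ε hs).sqrt hx.1.ne').congr_deriv ?_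
    have := (Real.sqrt_pos.2 hx.1).ne'
    rw [rho, mul_assoc, Real.sqrt_mul hx.1.le]
    field_simp
  · simpa using (tendsto_phi_zero ε).sqrt
  · have := (((tendsto_phi_zero ε).const_sub 1).mul ((tendsto_phi_zero ε).add_const 1)).sqrt
    simpa using this.div_const 2

theorem tendsto_sqrt_one_sub_phi_div (ε : ℝ) :
    Tendsto (fun s => Real.sqrt (1 - phi ε s) / (beta ε - s)) (𝓝[<] (beta ε))
      (𝓝 (Real.sqrt 2 / 2)) := by
  have hmem : ∀ᶠ s in 𝓝[<] (beta ε), s ∈ Ioo 0 (beta ε) := Ioo_mem_nhdsLT (beta_pos ε)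
  refine HasDerivAt.lhopital_zero_nhdsLT
    (f' := fun s => -(Real.sqrt (phi ε s * (phi ε s + 1)) / 2)) (g' := fun _ => -1)
    (hmem.mono fun s hs => ?_)
    (Eventually.of_forall fun s => by simpa using (hasDerivAt_id s).const_sub (beta ε))
    (Eventually.of_forall fun _ => by norm_num) ?_ ?_ ?_
  · have hx := phi_mem ε hs
    have h1 : 0 < 1 - phi ε s := by linarith [hx.2]
    refine (((hasDerivAt_phi ε hs).const_sub 1).sqrt h1.ne').congr_deriv ?_
    have := (Real.sqrt_pos.2 h1).ne'
    rw [rho, mul_comm (phi ε s), mul_assoc, Real.sqrt_mul h1.le]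
    field_simp
  · simpa using ((tendsto_phi_beta ε).const_sub 1).sqrt
  · have h : Tendsto (fun s => beta ε - s) (𝓝 (beta ε)) (𝓝 (beta ε - beta ε)) :=
      tendsto_id.const_sub _
    rw [sub_self] at h
    exact h.mono_left nhdsWithin_le_nhds
  · have := ((tendsto_phi_beta ε).mul ((tendsto_phi_beta ε).add_const 1)).sqrt
    have := this.div_const 2
    norm_num at this
    simpa using this

/-- The singular part of `V` is `3/(16 φ)`, and `φ ~ s²/4`. -/
theorem isEquivalent_V_zero (ε : ℝ) :
    Asymptotics.IsEquivalent (𝓝[>] 0) (V ε) (fun s => 3 / 4 * s ^ (-2 : ℤ)) := by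
  have hmem : ∀ᶠ s in 𝓝[>] (0 : ℝ), s ∈ Ioo 0 (beta ε) := Ioo_mem_nhdsGT (beta_pos ε)
  rw [Asymptotics.isEquivalent_iff_tendsto_one (hmem.mono fun s hs => by
    have := hs.1; positivity)]
  have hφ := tendsto_phi_zero ε
  have hs0 : Tendsto (fun s : ℝ => s) (𝓝[>] 0) (𝓝 0) := tendsto_id.mono_left nhdsWithin_le_nhds
  have key : Tendsto (fun s => 4 / 3 * (-(phi ε s + 2 / ε) / 2 * s ^ 2 +
      (1 + phi ε s ^ 2 + 4 * phi ε s / ε) * (3 - 5 * phi ε s ^ 2 + 4 * phi ε s / ε) /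
        (16 * ((1 - phi ε s) * (phi ε s + 1))) / (Real.sqrt (phi ε s) / s) ^ 2))
      (𝓝[>] 0) (𝓝 (4 / 3 * (-(0 + 2 / ε) / 2 * 0 ^ 2 +
      (1 + 0 ^ 2 + 4 * 0 / ε) * (3 - 5 * 0 ^ 2 + 4 * 0 / ε) /
        (16 * ((1 - 0) * (0 + 1))) / (1 / 2) ^ 2))) := by
    refine Tendsto.const_mul _ (Tendsto.add ?_ (Tendsto.div (Tendsto.div ?_ ?_ ?_)
      ((tendsto_sqrt_phi_div ε).pow 2) ?_))
    · exact (((hφ.add_const _).neg).div_const 2).mul (hs0.pow 2)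
    · exact (((hφ.pow 2).const_add 1).add ((hφ.const_mul 4).div_const ε)).mul
        ((((hφ.pow 2).const_mul 5).const_sub 3).add ((hφ.const_mul 4).div_const ε))
    · exact ((hφ.const_sub 1).mul (hφ.add_const 1)).const_mul 16
    · norm_num
    · norm_num
  have e : (4 / 3 * (-(0 + 2 / ε) / 2 * 0 ^ 2 +
      (1 + 0 ^ 2 + 4 * 0 / ε) * (3 - 5 * 0 ^ 2 + 4 * 0 / ε) /
        (16 * ((1 - 0) * (0 + 1))) / (1 / 2) ^ 2) : ℝ) = 1 := by norm_num
  rw [e] at key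
  refine key.congr' (hmem.mono fun s hs => ?_)
  have hx := phi_mem ε hs
  have h0 := hs.1.ne'
  have h1 : 1 - phi ε s ≠ 0 := by linarith [hx.2]
  have h2 : phi ε s + 1 ≠ 0 := by linarith [hx.1]
  have h3 := hx.1.ne'
  rw [Pi.div_apply, V_eq_explicit ε hs, div_pow, Real.sq_sqrt hx.1.le]
  rw [zpow_neg]
  norm_cast
  field_simp

/-- The singular part of `V` is `(2 + 4/ε)(4/ε - 2)/(32 (1 - φ))`, and `1 - φ ~ (β - s)²/2`. -/
theorem isEquivalent_V_beta {ε : ℝ} (hε₀ : 0 < ε) (hε₂ : ε < 2) :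
    Asymptotics.IsEquivalent (𝓝[<] (beta ε)) (V ε)
      (fun s => (1 / ε ^ 2 - 1 / 4) * (beta ε - s) ^ (-2 : ℤ)) := by
  have hmem : ∀ᶠ s in 𝓝[<] (beta ε), s ∈ Ioo 0 (beta ε) := Ioo_mem_nhdsLT (beta_pos ε)
  -- Here `ε < 2` enters: the leading coefficient must not vanish for the quotient criterion to
  -- apply.
  have hκ : 1 / ε ^ 2 - 1 / 4 ≠ 0 := by
    have : 1 / ε ^ 2 - 1 / 4 = (2 - ε) * (2 + ε) / (4 * ε ^ 2) := by
      field_simp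
      ring
    rw [this]
    have : 0 < 2 - ε := by linarith
    positivity
  rw [Asymptotics.isEquivalent_iff_tendsto_one (hmem.mono fun s hs => by
    have := (sub_pos.2 hs.2).ne'; positivity)]
  have hφ := tendsto_phi_beta ε
  have hs0 : Tendsto (fun s : ℝ => beta ε - s) (𝓝[<] (beta ε)) (𝓝 0) := by
    have h : Tendsto (fun s => beta ε - s) (𝓝 (beta ε)) (𝓝 (beta ε - beta ε)) :=
      tendsto_id.const_sub _
    rw [sub_self] at h
    exact h.mono_left nhdsWithin_le_nhds
  have key : Tendsto (fun s => (1 / ε ^ 2 - 1 / 4)⁻¹ *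
      (-(phi ε s + 2 / ε) / 2 * (beta ε - s) ^ 2 +
      (1 + phi ε s ^ 2 + 4 * phi ε s / ε) * (3 - 5 * phi ε s ^ 2 + 4 * phi ε s / ε) /
        (16 * (phi ε s * (phi ε s + 1))) / (Real.sqrt (1 - phi ε s) / (beta ε - s)) ^ 2))
      (𝓝[<] (beta ε)) (𝓝 ((1 / ε ^ 2 - 1 / 4)⁻¹ * (-(1 + 2 / ε) / 2 * 0 ^ 2 +
      (1 + 1 ^ 2 + 4 * 1 / ε) * (3 - 5 * 1 ^ 2 + 4 * 1 / ε) /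
        (16 * (1 * (1 + 1))) / (Real.sqrt 2 / 2) ^ 2))) := by
    refine Tendsto.const_mul _ (Tendsto.add ?_ (Tendsto.div (Tendsto.div ?_ ?_ ?_)
      ((tendsto_sqrt_one_sub_phi_div ε).pow 2) ?_))
    · exact (((hφ.add_const _).neg).div_const 2).mul (hs0.pow 2)
    · exact (((hφ.pow 2).const_add 1).add ((hφ.const_mul 4).div_const ε)).mul
        ((((hφ.pow 2).const_mul 5).const_sub 3).add ((hφ.const_mul 4).div_const ε))
    · exact (hφ.mul (hφ.add_const 1)).const_mul 16
    · norm_num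
    · positivity
  have e : ((1 / ε ^ 2 - 1 / 4)⁻¹ * (-(1 + 2 / ε) / 2 * 0 ^ 2 +
      (1 + 1 ^ 2 + 4 * 1 / ε) * (3 - 5 * 1 ^ 2 + 4 * 1 / ε) /
        (16 * (1 * (1 + 1))) / (Real.sqrt 2 / 2) ^ 2) : ℝ) = 1 := by
    rw [div_pow, Real.sq_sqrt (by norm_num), inv_mul_eq_one₀ hκ]
    field_simp
    ring
  rw [e] at key
  refine key.congr' (hmem.mono fun s hs => ?_)
  have hx := phi_mem ε hs
  have h0 := (sub_pos.2 hs.2).ne'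
  have h1 : 1 - phi ε s ≠ 0 := by linarith [hx.2]
  have h2 : phi ε s + 1 ≠ 0 := by linarith [hx.1]
  have h3 := hx.1.ne'
  rw [Pi.div_apply, V_eq_explicit ε hs, div_pow, Real.sq_sqrt (by linarith [hx.2]),
    zpow_neg, show (beta ε - s) ^ (2 : ℤ) = (beta ε - s) ^ 2 by norm_cast]
  generalize 1 / ε ^ 2 - 1 / 4 = κ at *
  field_simp

/-! ### First order operators on test functions -/

theorem contDiff_of_tsupport_subset {X : Type*} [NormedAddCommGroup X] [NormedSpace ℝ X]
    {f : ℝ → X} {U : Set ℝ} {n : WithTop ℕ∞} (hU : IsOpen U) (hf : ContDiffOn ℝ n f U)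
    (hs : tsupport f ⊆ U) : ContDiff ℝ n f := by
  refine contDiff_iff_contDiffAt.2 fun x => ?_
  by_cases hx : x ∈ tsupport f
  · exact hf.contDiffAt (hU.mem_nhds (hs hx))
  · exact contDiffAt_const.congr_of_eventuallyEq (notMem_tsupport_iff_eventuallyEq.1 hx)

theorem integrableOn_deriv_and_integral_eq_zero {X : Type*} [NormedAddCommGroup X]
    [NormedSpace ℝ X] {f : ℝ → X} {U : Set ℝ} (hU : IsOpen U)
    (hf : ContDiffOn ℝ 1 f U) (hc : HasCompactSupport f) (hs : tsupport f ⊆ U) :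
    IntegrableOn (deriv f) U ∧ ∫ s in U, deriv f s = 0 := by
  have h := contDiff_of_tsupport_subset hU hf hs
  have i1 : Integrable f := h.continuous.integrable_of_hasCompactSupport hc
  have i2 : Integrable (deriv f) :=
    (h.continuous_deriv le_rfl).integrable_of_hasCompactSupport hc.deriv
  refine ⟨i2.integrableOn, ?_⟩
  rw [setIntegral_eq_integral_of_forall_compl_eq_zero fun x hx =>
    deriv_of_notMem_tsupport fun h' => hx (hs h')]
  exact integral_eq_zero_of_hasDerivAt_of_integrable
    (fun x => (h.differentiable one_ne_zero x).hasDerivAt) i2 i1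

theorem inner_toLp {α : Type*} [MeasurableSpace α] {μ : Measure α} {f g : α → ℂ}
    (hf : MemLp f 2 μ) (hg : MemLp g 2 μ) :
    ⟪hf.toLp f, hg.toLp g⟫_ℂ = ∫ s, ⟪f s, g s⟫_ℂ ∂μ := by
  rw [L2.inner_def]
  refine integral_congr_ae ?_
  filter_upwards [hf.coeFn_toLp, hg.coeFn_toLp] with s h1 h2
  rw [h1, h2]

theorem integrable_inner_of_memLp {α : Type*} [MeasurableSpace α] {μ : Measure α} {f g : α → ℂ}
    (hf : MemLp f 2 μ) (hg : MemLp g 2 μ) : Integrable (fun s => ⟪f s, g s⟫_ℂ) μ := by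
  refine (L2.integrable_inner (hf.toLp f) (hg.toLp g)).congr ?_
  filter_upwards [hf.coeFn_toLp, hg.coeFn_toLp] with s h1 h2
  rw [h1, h2]

theorem norm_sq_toLp {α : Type*} [MeasurableSpace α] {μ : Measure α} {f : α → ℂ}
    (hf : MemLp f 2 μ) : ‖hf.toLp f‖ ^ 2 = ∫ s, ‖f s‖ ^ 2 ∂μ := by
  have h : ((‖hf.toLp f‖ ^ 2 : ℝ) : ℂ) = ((∫ s, ‖f s‖ ^ 2 ∂μ : ℝ) : ℂ) := by
    rw [← integral_complex_ofReal]
    have := inner_self_eq_norm_sq_to_K (𝕜 := ℂ) (hf.toLp f)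
    rw [inner_toLp] at this
    simp only [inner_self_eq_norm_sq_to_K] at this
    push_cast
    simpa using this.symm
  exact_mod_cast h

section TestFunctions

variable {b : ℝ}

theorem Test.contDiff_top (g : Test b) : ContDiff ℝ ∞ g := g.contDiff

theorem Test.hasDerivAt (g : Test b) (s : ℝ) : HasDerivAt g (deriv g s) s :=
  ((Test.contDiff_top g).differentiable (by norm_num) s).hasDerivAt

/-- the inclusion of `C_c^∞(0, b)` in `L²(0, b)` as a linear map -/
def Test.toL2ₗ (b : ℝ) : Test b →ₗ[ℂ] L2 b where
  toFun := Test.toL2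
  map_add' _ _ := rfl
  map_smul' _ _ := rfl

theorem Test.tsupport_twist (θ : ℝ → ℝ) (g : Test b) :
    tsupport (fun s => deriv g s - θ s • g s) ⊆ tsupport g := by
  refine closure_minimal (fun s hs => ?_) (isClosed_tsupport _)
  by_contra h
  exact hs (by simp [deriv_of_notMem_tsupport h, image_eq_zero_of_notMem_tsupport h])

theorem Test.contDiff_twist {θ : ℝ → ℝ} (hθ : ContDiffOn ℝ ∞ θ (Ioo 0 b)) (g : Test b) :
    ContDiff ℝ ∞ fun s => deriv g s - θ s • g s :=
  contDiff_of_tsupport_subset isOpen_Ioo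
    ((((contDiff_infty_iff_deriv.1 (Test.contDiff_top g)).2).contDiffOn).sub
      (hθ.smul (Test.contDiff_top g).contDiffOn))
    ((Test.tsupport_twist θ g).trans g.tsupport_subset)

/-- the operator `g ↦ g' - θ g` on test functions -/
def Test.twist {θ : ℝ → ℝ} (hθ : ContDiffOn ℝ ∞ θ (Ioo 0 b)) : Test b →ₗ[ℂ] Test b where
  toFun g := ⟨fun s => deriv g s - θ s • g s, Test.contDiff_twist hθ g,
    g.hasCompactSupport.of_isClosed_subset (isClosed_tsupport _) (Test.tsupport_twist θ g),
    (Test.tsupport_twist θ g).trans g.tsupport_subset⟩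
  map_add' f g := by
    ext s
    change deriv (⇑f + ⇑g) s - θ s • (f s + g s) =
      deriv f s - θ s • f s + (deriv g s - θ s • g s)
    rw [deriv_add (Test.hasDerivAt f s).differentiableAt (Test.hasDerivAt g s).differentiableAt,
      smul_add]
    abel
  map_smul' a g := by
    ext s
    change deriv (a • ⇑g) s - θ s • (a • g s) = a • (deriv g s - θ s • g s)
    rw [deriv_const_smul_field, smul_sub, smul_comm]

theorem Test.twist_apply {θ : ℝ → ℝ} (hθ : ContDiffOn ℝ ∞ θ (Ioo 0 b)) (g : Test b) (s : ℝ) :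
    Test.twist hθ g s = deriv g s - θ s • g s := rfl

theorem Test.norm_sq_toL2 (g : Test b) : ‖g.toL2‖ ^ 2 = ∫ s in Ioo 0 b, ‖g s‖ ^ 2 :=
  norm_sq_toLp g.memLp

theorem Test.integrableOn_norm_sq (g : Test b) : IntegrableOn (fun s => ‖g s‖ ^ 2) (Ioo 0 b) :=
  (memLp_two_iff_integrable_sq_norm g.memLp.1).1 g.memLp

/-- `∫ |g' - θ g|² = ∫ (|g'|² + (θ' + θ²) |g|²)` -/
theorem Test.norm_sq_twist {θ θ' W : ℝ → ℝ} (hθ : ContDiffOn ℝ ∞ θ (Ioo 0 b))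
    (hθ' : ∀ s ∈ Ioo 0 b, HasDerivAt θ (θ' s) s) (hW : ∀ s ∈ Ioo 0 b, W s = θ' s + θ s ^ 2)
    (g : Test b) :
    IntegrableOn (fun s => ‖deriv g s‖ ^ 2 + W s * ‖g s‖ ^ 2) (Ioo 0 b) ∧
      ∫ s in Ioo 0 b, (‖deriv g s‖ ^ 2 + W s * ‖g s‖ ^ 2) = ‖(Test.twist hθ g).toL2‖ ^ 2 := by
  have hg2 : ContDiff ℝ ∞ fun s => ‖g s‖ ^ 2 := (Test.contDiff_top g).norm_sq ℝ
  have hF : ContDiffOn ℝ 1 (fun s => θ s * ‖g s‖ ^ 2) (Ioo 0 b) :=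
    (hθ.mul hg2.contDiffOn).of_le (by norm_cast)
  have hs : Function.support (fun s => θ s * ‖g s‖ ^ 2) ⊆ Function.support g := by
    intro s
    simp only [Function.mem_support, ne_eq, mul_eq_zero, not_or]
    rintro ⟨-, h⟩ h0
    exact h (by simp [h0])
  obtain ⟨i1, i2⟩ := integrableOn_deriv_and_integral_eq_zero isOpen_Ioo hF
    (g.hasCompactSupport.mono hs) ((closure_mono hs).trans g.tsupport_subset)
  -- The cross term of `‖g' - θ g‖²` cancels against that of `(θ ‖g‖²)'`, whose integral is zero.
  have e : EqOn (fun s => ‖deriv g s‖ ^ 2 + W s * ‖g s‖ ^ 2)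
      (fun s => ‖Test.twist hθ g s‖ ^ 2 + deriv (fun s => θ s * ‖g s‖ ^ 2) s) (Ioo 0 b) := by
    intro s hs
    have d : HasDerivAt (fun s => θ s * ‖g s‖ ^ 2) _ s :=
      (hθ' s hs).mul (Test.hasDerivAt g s).norm_sq
    beta_reduce
    rw [d.deriv, Test.twist_apply, norm_sub_sq_real, hW s hs, real_inner_smul_right,
      real_inner_comm, norm_smul, mul_pow, Real.norm_eq_abs, sq_abs]
    ring
  have i3 := Test.integrableOn_norm_sq (Test.twist hθ g)
  refine ⟨(i3.add i1).congr_fun e.symm measurableSet_Ioo, ?_⟩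
  rw [setIntegral_congr_fun measurableSet_Ioo e, integral_add i3 i1, i2, add_zero,
    Test.norm_sq_toL2]

/-- Integration by parts. Only `g` has compact support, so no boundary behaviour of `G` is required;
this allows `G` to come from transformed functions in the domain of `L`. -/
theorem Test.inner_twist {θ : ℝ → ℝ} (hθ : ContDiffOn ℝ ∞ θ (Ioo 0 b)) (g : Test b)
    {G K : ℝ → ℂ} (hG : ContDiffOn ℝ 1 G (Ioo 0 b)) (mG : MemLp G 2 (volume.restrict (Ioo 0 b)))
    (mK : MemLp K 2 (volume.restrict (Ioo 0 b)))
    (hK : ∀ s ∈ Ioo 0 b, K s = -(deriv G s + θ s • G s)) :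
    ⟪(Test.twist hθ g).toL2, mG.toLp G⟫_ℂ = ⟪g.toL2, mK.toLp K⟫_ℂ := by
  have hs : Function.support (fun s => ⟪g s, G s⟫_ℂ) ⊆ Function.support g := by
    intro s
    rw [Function.mem_support, Function.mem_support, not_imp_not]
    intro h
    rw [h, inner_zero_left]
  have hF : ContDiffOn ℝ 1 (fun s => ⟪g s, G s⟫_ℂ) (Ioo 0 b) :=
    ContDiffOn.inner ℂ ((Test.contDiff_top g).contDiffOn.of_le (by norm_cast)) hG
  obtain ⟨i1, i2⟩ := integrableOn_deriv_and_integral_eq_zero isOpen_Ioo hF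
    (g.hasCompactSupport.mono hs) ((closure_mono hs).trans g.tsupport_subset)
  rw [Test.toL2, Test.toL2, inner_toLp, inner_toLp, ← sub_eq_zero,
    ← integral_sub (integrable_inner_of_memLp (Test.memLp _) mG)
      (integrable_inner_of_memLp (Test.memLp _) mK), ← i2]
  refine setIntegral_congr_fun measurableSet_Ioo fun s hs => ?_
  have d : HasDerivAt (fun s => ⟪g s, G s⟫_ℂ) _ s := (Test.hasDerivAt g s).inner ℂ
    ((hG.contDiffAt (isOpen_Ioo.mem_nhds hs)).differentiableAt one_ne_zero).hasDerivAt
  rw [d.deriv, Test.twist_apply, hK s hs, inner_sub_left, inner_neg_right, inner_add_right,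
    ← Complex.coe_smul, ← Complex.coe_smul, inner_smul_left, inner_smul_right,
    Complex.conj_ofReal]
  ring

theorem Test.inner_twist_test {θ : ℝ → ℝ} (hθ : ContDiffOn ℝ ∞ θ (Ioo 0 b)) (g h : Test b) :
    ⟪(Test.twist hθ g).toL2, h.toL2⟫_ℂ = ⟪g.toL2, (-(Test.twist hθ.neg h)).toL2⟫_ℂ := by
  refine Test.inner_twist hθ g ((Test.contDiff_top h).contDiffOn.of_le (by norm_cast)) h.memLp
    (Test.memLp _) fun s _ => ?_
  change -(deriv h s - -θ s • h s) = _
  rw [neg_smul, sub_neg_eq_add]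

/-- A function orthogonal to all test functions vanishes by the fundamental lemma of the calculus of
variations; real-valued test functions suffice. -/
theorem Test.denseRange_toL2 : DenseRange (Test.toL2 (b := b)) := by
  have : (LinearMap.range (Test.toL2ₗ b)).topologicalClosure = ⊤ := by
    rw [Submodule.topologicalClosure_eq_top_iff, Submodule.eq_bot_iff]
    intro f hf
    have hfi : IntegrableOn f (Ioo 0 b) := (Lp.memLp f).integrable (by norm_num)
    have h0 := isOpen_Ioo.ae_eq_zero_of_integral_contDiff_smul_eq_zero
      hfi.locallyIntegrableOn fun g h1 h2 h3 => ?_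
    · refine Lp.ext (EventuallyEq.trans ?_ (Lp.coeFn_zero _ _ _).symm)
      exact (ae_restrict_iff' measurableSet_Ioo).2 h0
    · have hs : Function.support (fun s => (g s : ℂ)) ⊆ Function.support g := by
        intro s
        simp
      let G : Test b := ⟨fun s => (g s : ℂ), Complex.ofRealCLM.contDiff.comp h1, h2.mono hs,
        (closure_mono hs).trans h3⟩
      have h4 := hf (Test.toL2 G) ⟨G, rfl⟩
      rw [Test.toL2, ← Lp.toLp_coeFn f (Lp.memLp f), inner_toLp,
        setIntegral_eq_integral_of_forall_compl_eq_zero fun x hx => ?_] at h4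
      · rw [← h4]
        refine integral_congr_ae (Eventually.of_forall fun s => ?_)
        change _ = ⟪((g s : ℝ) : ℂ), f s⟫_ℂ
        simp [mul_comm]
      · have : g x = 0 := image_eq_zero_of_notMem_tsupport fun h => hx (h3 h)
        change ⟪((g x : ℝ) : ℂ), f x⟫_ℂ = 0
        rw [this]
        simp
  intro y
  have h : y ∈ (LinearMap.range (Test.toL2ₗ b)).topologicalClosure := this ▸ Submodule.mem_top
  simpa using! h

/-- Against a test function `h` the operator moves to its formal adjoint, so the pairings tend to
`0` with `u n`. -/
theorem Test.twist_closable {θ : ℝ → ℝ} (hθ : ContDiffOn ℝ ∞ θ (Ioo 0 b)) (u : ℕ → Test b)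
    (v : L2 b) (hu : Tendsto (fun n => (u n).toL2) atTop (𝓝 0))
    (hv : Tendsto (fun n => (Test.twist hθ (u n)).toL2) atTop (𝓝 v)) : v = 0 := by
  refine Test.denseRange_toL2.eq_zero_of_inner_left ℂ fun h => ?_
  refine tendsto_nhds_unique (hv.inner tendsto_const_nhds) ?_
  simp only [Test.inner_twist_test]
  simpa using hu.inner (tendsto_const_nhds (x := (-(Test.twist hθ.neg h)).toL2))

end TestFunctions

/-! ### The Schrödinger form -/

theorem schrodingerForm_eq (ε : ℝ) (g : Test (beta ε)) :
    IntegrableOn (schrodingerDensity ε g) (Ioo 0 (beta ε)) ∧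
      schrodingerForm ε g = ‖(Test.twist (contDiffOn_theta ε) g).toL2‖ ^ 2 :=
  Test.norm_sq_twist (contDiffOn_theta ε) (fun _ hs => hasDerivAt_theta ε hs)
    (fun _ hs => V_eq ε hs) g

/-- the logarithmic derivative of `φ / c` -/
def theta₁ (ε s : ℝ) : ℝ := theta ε s + rho (phi ε s) / phi ε s

theorem contDiffOn_theta₁ (ε : ℝ) : ContDiffOn ℝ ∞ (theta₁ ε) (Ioo 0 (beta ε)) :=
  (contDiffOn_theta ε).add ((contDiffOn_rho.comp (contDiffOn_phi ε) fun _ hs => phi_mem ε hs).div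
    (contDiffOn_phi ε) fun _ hs => (phi_mem ε hs).1.ne')

/-- The Riccati equation of `F = φ/c`, the transform of `f(x) = x`: from `L x = 2 (x + 1/ε) x` comes
`F'' = (V - 2 (φ + 1/ε)) F`. -/
theorem hasDerivAt_theta₁ (ε : ℝ) {s : ℝ} (hs : s ∈ Ioo 0 (beta ε)) :
    HasDerivAt (theta₁ ε) (V ε s - 2 * (phi ε s + 1 / ε) - theta₁ ε s ^ 2) s := by
  have hx := phi_mem ε hs
  have h := (hasDerivAt_theta ε hs).add (((hasDerivAt_rho hx).comp s (hasDerivAt_phi ε hs)).div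
    (hasDerivAt_phi ε hs) hx.1.ne')
  refine h.congr_deriv ?_
  have hr := (rho_pos hx).ne'
  have h0 := hx.1.ne'
  rw [V_eq ε hs, theta₁, theta, logDer]
  simp only [Function.comp]
  field_simp
  ring

/-- The Poincaré inequality `∫ |g|² ≤ (ε / 2) ∫ (|g'|² + V |g|²)`. -/
theorem poincare {ε : ℝ} (hε : 0 < ε) (g : Test (beta ε)) :
    ‖g.toL2‖ ^ 2 ≤ ε / 2 * ‖(Test.twist (contDiffOn_theta ε) g).toL2‖ ^ 2 := by
  obtain ⟨i1, e1⟩ := schrodingerForm_eq ε g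
  -- The form with `V` lowered by `2 (φ + 1/ε) ≥ 2/ε` is still a square, so the original form
  -- exceeds `(2/ε) ‖g‖²`.
  obtain ⟨i2, e2⟩ := Test.norm_sq_twist (W := fun s => V ε s - 2 * (phi ε s + 1 / ε))
    (contDiffOn_theta₁ ε) (fun _ hs => hasDerivAt_theta₁ ε hs) (fun _ _ => by ring) g
  have h2 : 0 ≤ ‖(Test.twist (contDiffOn_theta₁ ε) g).toL2‖ ^ 2 := by positivity
  have h : ∫ s in Ioo 0 (beta ε), 2 / ε * ‖g s‖ ^ 2 ≤
      ‖(Test.twist (contDiffOn_theta ε) g).toL2‖ ^ 2 -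
        ‖(Test.twist (contDiffOn_theta₁ ε) g).toL2‖ ^ 2 := by
    rw [← e1, ← e2, schrodingerForm, ← integral_sub i1 i2]
    refine setIntegral_mono_on ((Test.integrableOn_norm_sq g).const_mul _) (i1.sub i2)
      measurableSet_Ioo fun s hs => ?_
    have hx := (phi_mem ε hs).1
    simp only [schrodingerDensity]
    have : 0 ≤ phi ε s * ‖g s‖ ^ 2 := by positivity
    have e : 2 / ε * ‖g s‖ ^ 2 = 2 * (1 / ε * ‖g s‖ ^ 2) := by ring
    rw [e]
    linarith
  rw [integral_const_mul, ← Test.norm_sq_toL2] at h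
  have h3 : 2 / ε * ‖g.toL2‖ ^ 2 ≤ ‖(Test.twist (contDiffOn_theta ε) g).toL2‖ ^ 2 := by linarith
  calc ‖g.toL2‖ ^ 2 = ε / 2 * (2 / ε * ‖g.toL2‖ ^ 2) := by field_simp
    _ ≤ _ := by gcongr

/-! ### Solving the Sturm-Liouville equation -/

theorem contDiff_primitive {X : Type*} [NormedAddCommGroup X] [NormedSpace ℝ X] [CompleteSpace X]
    {k : ℝ → X} (hk : ContDiff ℝ ∞ k) (a : ℝ) :
    (∀ y, HasDerivAt (fun y => ∫ t in y..a, k t) (-k y) y) ∧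
      ContDiff ℝ ∞ fun y => ∫ t in y..a, k t := by
  have hd : ∀ y, HasDerivAt (fun y => ∫ t in y..a, k t) (-k y) y := fun y =>
    intervalIntegral.integral_hasDerivAt_left (hk.continuous.intervalIntegrable _ _)
      hk.continuous.stronglyMeasurable.stronglyMeasurableAtFilter hk.continuous.continuousAt
  refine ⟨hd, contDiff_infty_iff_deriv.2 ⟨fun y => (hd y).differentiableAt, ?_⟩⟩
  rw [show deriv (fun y => ∫ t in y..a, k t) = fun y => -k y from funext fun y => (hd y).deriv]
  exact hk.neg

theorem contDiffOn_primitive {X : Type*} [NormedAddCommGroup X] [NormedSpace ℝ X]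
    [CompleteSpace X] {q : ℝ → X} {U : Set ℝ} (hU : IsOpen U) (hc : U.OrdConnected)
    (hq : ContDiffOn ℝ ∞ q U) {a : ℝ} (ha : a ∈ U) :
    (∀ x ∈ U, HasDerivAt (fun x => ∫ t in a..x, q t) (q x) x) ∧
      ContDiffOn ℝ ∞ (fun x => ∫ t in a..x, q t) U := by
  have hd : ∀ x ∈ U, HasDerivAt (fun x => ∫ t in a..x, q t) (q x) x := fun x hx =>
    intervalIntegral.integral_hasDerivAt_right
      (hq.continuousOn.mono (hc.uIcc_subset ha hx)).intervalIntegrable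
      (hq.continuousOn.stronglyMeasurableAtFilter hU x hx)
      (hq.continuousOn.continuousAt (hU.mem_nhds hx))
  refine ⟨hd, (contDiffOn_infty_iff_deriv_of_isOpen hU).2
    ⟨fun x hx => (hd x hx).differentiableAt.differentiableWithinAt, ?_⟩⟩
  exact hq.congr fun x hx => (hd x hx).deriv

/-- The equation `-(p f')' = k` is solvable in `C₀^∞([0, 1])` for `k ∈ C_c^∞(0, 1)`. -/
theorem exists_smoothVanishing_of_source (ε : ℝ) {k : ℝ → ℂ} (hk : ContDiff ℝ ∞ k)
    (hs : tsupport k ⊆ Ioo 0 1) :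
    ∃ f ∈ smoothVanishing, ∀ x ∈ Ioo (0 : ℝ) 1, slExpr ε f x = (w ε x)⁻¹ • k x := by
  obtain ⟨hPd, hP⟩ := contDiff_primitive hk 1
  set P : ℝ → ℂ := fun y => ∫ t in y..1, k t with hPdef
  -- Integrating from the end point `1` makes `P = p f'` vanish near `1`, where `p` degenerates, so
  -- `P/p` is smooth on the neighbourhood `(-1, ∞)` of `[0, 1]`.
  have h1 : ∀ x, 1 ≤ x → P =ᶠ[𝓝 x] 0 := by
    intro x hx
    have h1 : (1 : ℝ) ∉ tsupport k := fun h => lt_irrefl _ (hs h).2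
    obtain ⟨l, hl1, hl⟩ := exists_Ioc_subset_of_mem_nhds
      (notMem_tsupport_iff_eventuallyEq.1 h1) ⟨0, zero_lt_one⟩
    refine eventually_of_mem (Ioi_mem_nhds (hl1.trans_le hx)) fun y hy => ?_
    refine intervalIntegral.integral_zero_ae (Eventually.of_forall fun t ht => ?_)
    rcases le_or_gt t 1 with h | h
    · refine hl ⟨?_, h⟩
      rcases mem_uIoc.1 ht with h' | h'
      · exact lt_trans hy h'.1
      · exact absurd h'.1 (not_lt.2 h)
    · exact image_eq_zero_of_notMem_tsupport fun h' => lt_asymm h (hs h').2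
  have hq : ContDiffOn ℝ ∞ (fun y => (p ε y)⁻¹ • P y) (Ioi (-1)) := by
    intro x hx
    refine ContDiffAt.contDiffWithinAt ?_
    rcases lt_or_ge x 1 with h | h
    · have hx' : x ∈ Ioo (-1 : ℝ) 1 := ⟨hx, h⟩
      exact (((contDiffOn_p ε).contDiffAt (isOpen_Ioo.mem_nhds hx')).inv (p_pos ε hx').ne').smul
        hP.contDiffAt
    · refine (contDiffAt_const (c := (0 : ℂ))).congr_of_eventuallyEq ?_
      filter_upwards [h1 x h] with y hy
      rw [hy, Pi.zero_apply, smul_zero]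
  obtain ⟨hfd, hf⟩ := contDiffOn_primitive isOpen_Ioi ordConnected_Ioi hq
    (show (0 : ℝ) ∈ Ioi (-1) by norm_num)
  refine ⟨_, ⟨hf.mono fun x hx => lt_of_lt_of_le (by norm_num) hx.1,
    intervalIntegral.integral_same⟩, fun x hx => ?_⟩
  have e : (fun y => p ε y • deriv (fun x => ∫ t in (0 : ℝ)..x, (p ε t)⁻¹ • P t) y)
      =ᶠ[𝓝 x] P := by
    refine eventually_of_mem (isOpen_Ioo.mem_nhds hx) fun y hy => ?_
    have hy' : y ∈ Ioo (-1 : ℝ) 1 := ⟨by linarith [hy.1], hy.2⟩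
    beta_reduce
    rw [(hfd y hy'.1).deriv, smul_smul, mul_inv_cancel₀ (p_pos ε hy').ne', one_smul]
  rw [slExpr, e.deriv_eq, (hPd x).deriv, smul_neg, neg_neg]

theorem exists_smoothVanishing (ε : ℝ) (h : Test (beta ε)) :
    ∃ f ∈ smoothVanishing, ∀ s ∈ Ioo 0 (beta ε),
      amp ε (phi ε s) • slExpr ε f (phi ε s) = h s := by
  -- The source is chosen so that the transform of `k/w` is `h`.
  let k : ℝ → ℂ := (Ioo (0 : ℝ) 1).indicator fun x => (w ε x / amp ε x) • h (psi ε x)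
  have hk0 : ∀ x ∈ Ioo (0 : ℝ) 1, k x = (w ε x / amp ε x) • h (psi ε x) := fun x hx =>
    indicator_of_mem hx _
  have hS : IsCompact (phi ε '' tsupport h) := h.hasCompactSupport.isCompact.image_of_continuousOn
    ((continuousOn_phi ε).mono (h.tsupport_subset.trans Ioo_subset_Icc_self))
  have hsub : tsupport k ⊆ phi ε '' tsupport h := by
    refine closure_minimal (fun x hx => ?_) hS.isClosed
    have hx1 : x ∈ Ioo (0 : ℝ) 1 := by
      by_contra h'
      exact hx (indicator_of_notMem h' _)
    refine ⟨psi ε x, ?_, phi_psi ε (Ioo_subset_Icc_self hx1)⟩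
    by_contra h'
    refine hx ?_
    rw [hk0 x hx1, image_eq_zero_of_notMem_tsupport h', smul_zero]
  have hsub' : tsupport k ⊆ Ioo 0 1 := by
    refine hsub.trans ?_
    rintro _ ⟨s, hs, rfl⟩
    exact phi_mem ε (h.tsupport_subset hs)
  have hψ : ContDiffOn ℝ ∞ (psi ε) (Ioo 0 1) := by
    refine (contDiffOn_infty_iff_deriv_of_isOpen isOpen_Ioo).2
      ⟨fun x hx => (hasDerivAt_psi ε hx).differentiableAt.differentiableWithinAt, ?_⟩
    exact (contDiffOn_rho.inv fun x hx => (rho_pos hx).ne').congr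
      fun x hx => (hasDerivAt_psi ε hx).deriv
  have hk : ContDiff ℝ ∞ k := by
    refine contDiff_of_tsupport_subset isOpen_Ioo (ContDiffOn.congr ?_ hk0) hsub'
    exact ((contDiffOn_w ε).div (contDiffOn_amp ε) fun x hx => (amp_pos ε hx).ne').smul
      ((Test.contDiff_top h).comp_contDiffOn hψ)
  obtain ⟨f, hf, hfk⟩ := exists_smoothVanishing_of_source ε hk hsub'
  refine ⟨f, hf, fun s hs => ?_⟩
  have hx := phi_mem ε hs
  rw [hfk _ hx, hk0 _ hx, psi_phi ε (Ioo_subset_Icc_self hs), smul_smul, smul_smul]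
  have h1 := (w_pos ε hx).ne'
  have h2 := (amp_pos ε hx).ne'
  rw [show amp ε (phi ε s) * (w ε (phi ε s))⁻¹ * (w ε (phi ε s) / amp ε (phi ε s)) = 1 by
    field_simp, one_smul]

/-! ### The unitary operator -/

/-- The preimage under `φ` of an exceptional set is its image under `ψ`, and a differentiable map
sends null sets to null sets. -/
theorem ae_comp_phi (ε : ℝ) {P : ℝ → Prop} (h : ∀ᵐ x ∂weightMeasure ε, P x) :
    ∀ᵐ s ∂volume.restrict (Ioo 0 (beta ε)), P (phi ε s) := by
  rw [ae_weight_iff, ae_restrict_iff' measurableSet_Ioo] at h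
  rw [ae_restrict_iff' measurableSet_Ioo]
  have h0 : volume {x | ¬(x ∈ Ioo (0 : ℝ) 1 → P x)} = 0 := h
  have h1 : volume (psi ε '' {x | ¬(x ∈ Ioo (0 : ℝ) 1 → P x)}) = 0 := by
    refine addHaar_image_eq_zero_of_differentiableOn_of_addHaar_eq_zero volume (fun x hx => ?_) h0
    exact (hasDerivAt_psi ε (Classical.not_imp.1 hx).1).differentiableAt.differentiableWithinAt
  refine measure_mono_null (fun s hs => ?_) h1
  obtain ⟨h2, h3⟩ := Classical.not_imp.1 hs
  exact ⟨phi ε s, fun h => h3 (h (phi_mem ε h2)), psi_phi ε (Ioo_subset_Icc_self h2)⟩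

/-- `f ↦ c⁻¹ f ∘ φ` -/
def transform (ε : ℝ) (f : ℝ → ℂ) (s : ℝ) : ℂ := amp ε (phi ε s) • f (phi ε s)

theorem aestronglyMeasurable_transform (ε : ℝ) {f : ℝ → ℂ}
    (hf : AEStronglyMeasurable f (weightMeasure ε)) :
    AEStronglyMeasurable (transform ε f) (volume.restrict (Ioo 0 (beta ε))) := by
  have h1 : AEMeasurable (phi ε) (volume.restrict (Ioo 0 (beta ε))) :=
    (contDiffOn_phi ε).continuousOn.aemeasurable measurableSet_Ioo
  have h2 : AEStronglyMeasurable (fun s => amp ε (phi ε s)) (volume.restrict (Ioo 0 (beta ε))) :=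
    ContinuousOn.aestronglyMeasurable
      ((contDiffOn_amp ε).continuousOn.comp (contDiffOn_phi ε).continuousOn
        fun _ hs => phi_mem ε hs) measurableSet_Ioo
  refine (h2.smul
    (hf.stronglyMeasurable_mk.measurable.comp_aemeasurable h1).aestronglyMeasurable).congr ?_
  filter_upwards [ae_comp_phi ε hf.ae_eq_mk] with s hs
  simp only [transform, Pi.smul_apply', Function.comp, hs]

/-- Substitution `x = φ(s)`: the weight times the Jacobian is `w ρ = a²`, the factor supplied by the
transform. -/
theorem lintegral_transform (ε : ℝ) {f : ℝ → ℂ} (hf : AEStronglyMeasurable f (weightMeasure ε)) :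
    ∫⁻ s in Ioo 0 (beta ε), ‖transform ε f s‖ₑ ^ (2 : ℝ) =
      ∫⁻ x, ‖f x‖ₑ ^ (2 : ℝ) ∂weightMeasure ε := by
  have hw : Measurable fun x => ENNReal.ofReal (w ε x) := (measurable_w ε).ennreal_ofReal
  have e : ∫⁻ x, ‖f x‖ₑ ^ (2 : ℝ) ∂weightMeasure ε =
      ∫⁻ x in Ioo 0 1, ENNReal.ofReal (w ε x) * ‖f x‖ₑ ^ (2 : ℝ) :=
    lintegral_withDensity_eq_lintegral_mul₀' hw.aemeasurable (hf.enorm.pow_const _)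
  rw [e, ← image_phi ε, lintegral_image_eq_lintegral_abs_deriv_mul measurableSet_Ioo
    (fun s hs => (hasDerivAt_phi ε hs).hasDerivWithinAt)
    ((strictMonoOn_phi ε).injOn.mono Ioo_subset_Icc_self)]
  refine setLIntegral_congr_fun measurableSet_Ioo fun s hs => ?_
  have hx := phi_mem ε hs
  rw [transform, enorm_smul, ENNReal.mul_rpow_of_nonneg _ _ zero_le_two, ← mul_assoc,
    abs_of_pos (rho_pos hx), ← ENNReal.ofReal_mul (rho_pos hx).le, ← amp_sq ε hx,
    Real.enorm_of_nonneg (amp_pos ε hx).le,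
    ENNReal.ofReal_rpow_of_nonneg (amp_pos ε hx).le zero_le_two, Real.rpow_two]

theorem eLpNorm_transform (ε : ℝ) {f : ℝ → ℂ} (hf : AEStronglyMeasurable f (weightMeasure ε)) :
    eLpNorm (transform ε f) 2 (volume.restrict (Ioo 0 (beta ε))) =
      eLpNorm f 2 (weightMeasure ε) := by
  rw [eLpNorm_eq_lintegral_rpow_enorm_toReal two_ne_zero ENNReal.ofNat_ne_top,
    eLpNorm_eq_lintegral_rpow_enorm_toReal two_ne_zero ENNReal.ofNat_ne_top]
  simp only [ENNReal.toReal_ofNat]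
  rw [lintegral_transform ε hf]

theorem memLp_transform (ε : ℝ) {f : ℝ → ℂ} (hf : MemLp f 2 (weightMeasure ε)) :
    MemLp (transform ε f) 2 (volume.restrict (Ioo 0 (beta ε))) :=
  ⟨aestronglyMeasurable_transform ε hf.1, (eLpNorm_transform ε hf.1).trans_lt hf.2⟩

/-- the isometry `f ↦ c⁻¹ f ∘ φ` -/
def transformLI (ε : ℝ) : L2w ε →ₗᵢ[ℂ] L2 (beta ε) where
  toFun f := (memLp_transform ε (Lp.memLp f)).toLp (transform ε f)
  map_add' f g := by
    refine Lp.ext ?_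
    filter_upwards [ae_comp_phi ε (Lp.coeFn_add f g), Lp.coeFn_add
      ((memLp_transform ε (Lp.memLp f)).toLp (transform ε f))
      ((memLp_transform ε (Lp.memLp g)).toLp (transform ε g)),
      (memLp_transform ε (Lp.memLp f)).coeFn_toLp, (memLp_transform ε (Lp.memLp g)).coeFn_toLp,
      (memLp_transform ε (Lp.memLp (f + g))).coeFn_toLp] with s h1 h2 h3 h4 h5
    rw [h2, h5, Pi.add_apply, h3, h4, transform, h1, Pi.add_apply, smul_add]
    rfl
  map_smul' a f := by
    refine Lp.ext ?_
    filter_upwards [ae_comp_phi ε (Lp.coeFn_smul a f), Lp.coeFn_smul a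
      ((memLp_transform ε (Lp.memLp f)).toLp (transform ε f)),
      (memLp_transform ε (Lp.memLp f)).coeFn_toLp,
      (memLp_transform ε (Lp.memLp (a • f))).coeFn_toLp] with s h1 h2 h3 h4
    rw [RingHom.id_apply, h2, h4, Pi.smul_apply, h3, transform, h1, Pi.smul_apply, transform,
      smul_comm]
  norm_map' f := by
    change ‖(memLp_transform ε (Lp.memLp f)).toLp (transform ε f)‖ = _
    rw [Lp.norm_toLp, eLpNorm_transform ε (Lp.memLp f).1, Lp.norm_def]

theorem transformLI_ae (ε : ℝ) (f : L2w ε) :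
    transformLI ε f =ᵐ[volume.restrict (Ioo 0 (beta ε))] transform ε f :=
  (memLp_transform ε (Lp.memLp f)).coeFn_toLp

theorem transformLI_ae_of_ae (ε : ℝ) {F : L2w ε} {f : ℝ → ℂ} (h : F =ᵐ[weightMeasure ε] f) :
    transformLI ε F =ᵐ[volume.restrict (Ioo 0 (beta ε))] transform ε f := by
  refine (transformLI_ae ε F).trans ?_
  filter_upwards [ae_comp_phi ε h] with s hs
  rw [transform, hs, transform]

/-- Every test function is the image of an element of the range of the operator `L`. -/
theorem exists_slGraph_transform {ε : ℝ} (hε : 0 < ε) (h : Test (beta ε)) :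
    ∃ P ∈ slGraph ε, transformLI ε P.2 = h.toL2 := by
  obtain ⟨f, hf, hfh⟩ := exists_smoothVanishing ε h
  obtain ⟨h1, h2, h3⟩ := exists_mem_slGraph hε hf
  rw [sturmLiouville_graph] at h3
  refine ⟨_, h3, Lp.ext ?_⟩
  refine (transformLI_ae_of_ae ε h2.coeFn_toLp).trans (EventuallyEq.trans ?_
    h.memLp.coeFn_toLp.symm)
  filter_upwards [ae_restrict_mem measurableSet_Ioo] with s hs
  exact hfh s hs

/-- An isometry on a complete space has closed range, and solvability of the differential equation
puts every test function in it. -/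
theorem surjective_transformLI {ε : ℝ} (hε : 0 < ε) : Function.Surjective (transformLI ε) := by
  have hc : IsClosed (range (transformLI ε)) :=
    (transformLI ε).isometry.isClosedEmbedding.isClosed_range
  have hd : Dense (range (transformLI ε)) := Test.denseRange_toL2.mono (by
    rintro _ ⟨h, rfl⟩
    obtain ⟨P, -, hP⟩ := exists_slGraph_transform hε h
    exact ⟨_, hP⟩)
  exact range_eq_univ.1 (hc.closure_eq ▸ hd.closure_eq)

/-- the unitary operator `f ↦ c⁻¹ f ∘ φ` -/
def transformEquiv {ε : ℝ} (hε : 0 < ε) : L2w ε ≃ₗᵢ[ℂ] L2 (beta ε) :=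
  LinearIsometryEquiv.ofSurjective (transformLI ε) (surjective_transformLI hε)

theorem transformEquiv_ae {ε : ℝ} (hε : 0 < ε) (f : L2w ε) :
    transformEquiv hε f =ᵐ[volume.restrict (Ioo 0 (beta ε))]
      fun s => (c ε s)⁻¹ • f (phi ε s) := by
  refine (transformLI_ae ε f).trans ?_
  filter_upwards [ae_restrict_mem measurableSet_Ioo] with s hs
  rw [c_eq ε hs, inv_inv, transform]

/-! ### Cutoff functions -/

/-- a smooth function that is `0` on `(-∞, 1]` and `1` on `[2, ∞)` -/
def step (t : ℝ) : ℝ := Real.smoothTransition (t - 1)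

theorem contDiff_step : ContDiff ℝ ∞ step :=
  Real.smoothTransition.contDiff.comp (contDiff_id.sub contDiff_const)

theorem step_of_le {t : ℝ} (h : t ≤ 1) : step t = 0 :=
  Real.smoothTransition.zero_of_nonpos (by linarith)

theorem step_of_ge {t : ℝ} (h : 2 ≤ t) : step t = 1 :=
  Real.smoothTransition.one_of_one_le (by linarith)

theorem step_nonneg (t : ℝ) : 0 ≤ step t := Real.smoothTransition.nonneg _

theorem step_le_one (t : ℝ) : step t ≤ 1 := Real.smoothTransition.le_one _

theorem deriv_step_of_lt {t : ℝ} (h : t < 1) : deriv step t = 0 := by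
  have h' : step =ᶠ[𝓝 t] fun _ => 0 :=
    eventually_of_mem (Iio_mem_nhds h) fun s hs => step_of_le (le_of_lt hs)
  rw [h'.deriv_eq, deriv_const]

theorem deriv_step_of_gt {t : ℝ} (h : 2 < t) : deriv step t = 0 := by
  have h' : step =ᶠ[𝓝 t] fun _ => 1 :=
    eventually_of_mem (Ioi_mem_nhds h) fun s hs => step_of_ge (le_of_lt hs)
  rw [h'.deriv_eq, deriv_const]

theorem exists_bound_deriv_step : ∃ M : ℝ, ∀ t : ℝ, |t * deriv step t| ≤ M := by
  have hc : Continuous fun t => t * deriv step t :=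
    continuous_id.mul (contDiff_step.continuous_deriv (by norm_cast))
  refine hc.bounded_above_of_compact_support ?_
  refine HasCompactSupport.of_support_subset_isCompact (isCompact_Icc (a := (1 : ℝ)) (b := 2))
    fun t ht => ?_
  by_contra h
  refine ht ?_
  rw [mem_Icc, not_and_or, not_le, not_le] at h
  rcases h with h | h
  · simp only [deriv_step_of_lt h, mul_zero]
  · simp only [deriv_step_of_gt h, mul_zero]

/-- a smooth function on `[0, 1]` that vanishes near the end points -/
def cutoff (N x : ℝ) : ℝ := step (N * x) * step (N * (1 - x))

/-- the derivative of `cutoff` -/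
def cutoffDer (N x : ℝ) : ℝ :=
  N * deriv step (N * x) * step (N * (1 - x)) - step (N * x) * (N * deriv step (N * (1 - x)))

theorem hasDerivAt_cutoff (N x : ℝ) : HasDerivAt (cutoff N) (cutoffDer N x) x := by
  have d : ∀ t, HasDerivAt step (deriv step t) t := fun t =>
    (contDiff_step.differentiable (by norm_num) t).hasDerivAt
  have h1 : HasDerivAt (fun x => step (N * x)) _ x :=
    (d (N * x)).comp x ((hasDerivAt_id x).const_mul N)
  have h2 : HasDerivAt (fun x => step (N * (1 - x))) _ x :=
    HasDerivAt.comp (h₂ := step) x (d (N * (1 - x))) (((hasDerivAt_id x).const_sub 1).const_mul N)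
  refine (h1.mul h2).congr_deriv ?_
  rw [cutoffDer]
  ring

theorem contDiff_cutoff (N : ℝ) : ContDiff ℝ ∞ (cutoff N) :=
  (contDiff_step.comp (contDiff_const.mul contDiff_id)).mul
    (contDiff_step.comp (contDiff_const.mul (contDiff_const.sub contDiff_id)))

theorem cutoff_nonneg (N x : ℝ) : 0 ≤ cutoff N x := mul_nonneg (step_nonneg _) (step_nonneg _)

theorem cutoff_le_one (N x : ℝ) : cutoff N x ≤ 1 :=
  mul_le_one₀ (step_le_one _) (step_nonneg _) (step_le_one _)

theorem mem_Icc_of_cutoff_ne_zero {N x : ℝ} (hN : 0 < N) (h : cutoff N x ≠ 0) :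
    x ∈ Icc (1 / N) (1 - 1 / N) := by
  constructor
  · rw [div_le_iff₀ hN]
    by_contra! h'
    exact h (by rw [cutoff, step_of_le (by linarith), zero_mul])
  · have : 1 / N ≤ 1 - x := by
      rw [div_le_iff₀ hN]
      by_contra! h'
      exact h (by rw [cutoff, step_of_le (t := N * (1 - x)) (by linarith), mul_zero])
    linarith

theorem eventually_cutoff {x : ℝ} (hx : x ∈ Ioo (0 : ℝ) 1) :
    ∀ᶠ n : ℕ in atTop, cutoff (n + 1) x = 1 ∧ cutoffDer (n + 1) x = 0 := by
  have key : ∀ y : ℝ, 0 < y → ∀ᶠ n : ℕ in atTop, 2 < (n + 1 : ℝ) * y := fun y hy => by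
    have : Tendsto (fun n : ℕ => ((n : ℝ) + 1) * y) atTop atTop :=
      (tendsto_atTop_add_const_right _ 1 tendsto_natCast_atTop_atTop).atTop_mul_const hy
    exact this.eventually_gt_atTop 2
  filter_upwards [key x hx.1, key (1 - x) (by linarith [hx.2])] with n h1 h2
  rw [cutoff, cutoffDer, step_of_ge h1.le, step_of_ge h2.le, deriv_step_of_gt h1,
    deriv_step_of_gt h2]
  norm_num

/-- The weight `x (1 - x)` absorbs the factor `N`: both terms become `t * deriv step t`, at `t = N
x` or `t = N (1 - x)`. Hence the bound is uniform in `N`. -/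
theorem abs_cutoffDer_mul_le {M : ℝ} (hM : ∀ t, |t * deriv step t| ≤ M) {N x : ℝ}
    (hx : x ∈ Ioo (0 : ℝ) 1) : |cutoffDer N x| * x ≤ M / (1 - x) := by
  have h1 : 0 < 1 - x := by linarith [hx.2]
  have h0 := hx.1
  have e : cutoffDer N x * x * (1 - x) = N * x * deriv step (N * x) * step (N * (1 - x)) * (1 - x)
      - N * (1 - x) * deriv step (N * (1 - x)) * step (N * x) * x := by
    rw [cutoffDer]
    ring
  have b : ∀ t t' y, 0 ≤ y → |t * deriv step t * step t' * y| ≤ M * y := by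
    intro t t' y hy
    rw [abs_mul, abs_mul, abs_of_nonneg hy, abs_of_nonneg (step_nonneg t')]
    refine mul_le_mul_of_nonneg_right ?_ hy
    exact (mul_le_of_le_one_right (abs_nonneg _) (step_le_one _)).trans (hM t)
  rw [le_div_iff₀ h1]
  calc |cutoffDer N x| * x * (1 - x) = |cutoffDer N x * x * (1 - x)| := by
        rw [abs_mul, abs_mul, abs_of_pos h0, abs_of_pos h1]
    _ ≤ M * (1 - x) + M * x := by
        rw [e]
        exact (abs_sub _ _).trans (add_le_add (b _ _ _ h1.le) (b _ _ _ h0.le))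
    _ = M := by ring

theorem tendsto_toLp_of_dominated {α : Type*} [MeasurableSpace α] {μ : Measure α}
    {f : ℕ → α → ℂ} {g : α → ℂ} (hf : ∀ n, MemLp (f n) 2 μ) (hg : MemLp g 2 μ) {B : α → ℝ}
    (hB : Integrable B μ) (hb : ∀ n, ∀ᵐ s ∂μ, ‖f n s - g s‖ ^ 2 ≤ B s)
    (hl : ∀ᵐ s ∂μ, ∀ᶠ n in atTop, f n s = g s) :
    Tendsto (fun n => (hf n).toLp (f n)) atTop (𝓝 (hg.toLp g)) := by
  rw [tendsto_iff_norm_sub_tendsto_zero]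
  have h : Tendsto (fun n => ∫ s, ‖f n s - g s‖ ^ 2 ∂μ) atTop (𝓝 (∫ _, (0 : ℝ) ∂μ)) := by
    refine tendsto_integral_of_dominated_convergence B
      (fun n => ((hf n).1.sub hg.1).norm.pow 2) hB (fun n => ?_) ?_
    · filter_upwards [hb n] with s hs
      rwa [Real.norm_of_nonneg (by positivity)]
    · filter_upwards [hl] with s hs
      refine tendsto_const_nhds.congr' (hs.mono fun n hn => ?_)
      simp [hn]
  rw [integral_zero] at h
  have h2 := h.sqrt
  rw [Real.sqrt_zero] at h2
  refine h2.congr fun n => ?_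
  rw [← MemLp.toLp_sub, ← Real.sqrt_sq (norm_nonneg (((hf n).sub hg).toLp (f n - g))),
    norm_sq_toLp]
  rfl

/-! ### The transform of the domain of `L` -/

theorem exists_bound_of_smoothVanishing {f : ℝ → ℂ} (hf : f ∈ smoothVanishing) :
    ∃ A : ℝ, ∀ x ∈ Ioo (0 : ℝ) 1, ‖f x‖ ≤ A * x ∧ ‖deriv f x‖ ≤ A := by
  have c1 : ContinuousOn (derivWithin f (Icc 0 1)) (Icc 0 1) :=
    hf.1.continuousOn_derivWithin (uniqueDiffOn_Icc zero_lt_one) (by norm_cast)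
  obtain ⟨A, hA⟩ := isCompact_Icc.exists_bound_of_continuousOn c1
  refine ⟨A, fun x hx => ⟨?_, ?_⟩⟩
  · have := (convex_Icc (0 : ℝ) 1).norm_image_sub_le_of_norm_derivWithin_le
      (hf.1.differentiableOn (by norm_num)) hA (left_mem_Icc.2 zero_le_one)
      (Ioo_subset_Icc_self hx)
    simpa [hf.2, abs_of_pos hx.1] using this
  · rw [← derivWithin_of_mem_nhds (Icc_mem_nhds hx.1 hx.2)]
    exact hA x (Ioo_subset_Icc_self hx)

theorem p_le {ε : ℝ} (hε : 0 < ε) {x : ℝ} (hx : x ∈ Ioo (0 : ℝ) 1) :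
    p ε x ≤ 2 * (1 - x) ^ (1 + 1 / ε) := by
  have h1 : 0 < 1 - x := by linarith [hx.2]
  have h2 : 1 ≤ x + 1 := by linarith [hx.1]
  have h3 : (x + 1) ^ (1 - 1 / ε) ≤ 2 := by
    calc (x + 1) ^ (1 - 1 / ε) ≤ (x + 1) ^ (1 : ℝ) :=
          Real.rpow_le_rpow_of_exponent_le h2 (by
            have : 0 < 1 / ε := by positivity
            linarith)
      _ ≤ 2 := by
          rw [Real.rpow_one]
          linarith [hx.2]
  rw [p, mul_comm]
  exact mul_le_mul_of_nonneg_right h3 (by positivity)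

theorem amp_mul_rho_sq (ε : ℝ) {x : ℝ} (hx : x ∈ Ioo (0 : ℝ) 1) :
    (amp ε x * rho x) ^ 2 = p ε x * rho x := by
  rw [mul_pow, amp_sq ε hx, p_eq_rho_sq ε hx]
  ring

/-- This is the dominating function for the cutoff error; in the variable `x` it is `(1 - x)^{1/ε -
1}`, with exponent above `-1`. -/
theorem integrableOn_rpow_phi {ε : ℝ} (hε : 0 < ε) :
    IntegrableOn (fun s => rho (phi ε s) * (1 - phi ε s) ^ (1 / ε - 1)) (Ioo 0 (beta ε)) := by
  have h0 : -1 < 1 / ε - 1 := by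
    have : 0 < 1 / ε := by positivity
    linarith
  have h : IntegrableOn (fun x : ℝ => (1 - x) ^ (1 / ε - 1)) (Ioo 0 1) :=
    (intervalIntegrable_iff_integrableOn_Ioo_of_le zero_le_one).1
      (intervalIntegrable_rpow_one_sub h0)
  rw [← image_phi ε, integrableOn_image_iff_integrableOn_abs_deriv_smul measurableSet_Ioo
    (fun s hs => (hasDerivAt_phi ε hs).hasDerivWithinAt)
    ((strictMonoOn_phi ε).injOn.mono Ioo_subset_Icc_self)] at h
  refine h.congr_fun (fun s hs => ?_) measurableSet_Ioo
  beta_reduce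
  rw [abs_of_pos (rho_pos (phi_mem ε hs)), smul_eq_mul]

/-- the function `F' - θ F` for `F = c⁻¹ f ∘ φ` -/
def transformDer (ε : ℝ) (f : ℝ → ℂ) (s : ℝ) : ℂ :=
  (amp ε (phi ε s) * rho (phi ε s)) • deriv f (phi ε s)

theorem contDiffOn_transform {f : ℝ → ℂ} (hf : f ∈ smoothVanishing)
    (ε : ℝ) : ContDiffOn ℝ ∞ (transform ε f) (Ioo 0 (beta ε)) :=
  ((contDiffOn_amp ε).comp (contDiffOn_phi ε) fun _ hs => phi_mem ε hs).smul
    ((hf.1.mono Ioo_subset_Icc_self).comp (contDiffOn_phi ε) fun _ hs => phi_mem ε hs)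

theorem hasDerivAt_transform {f : ℝ → ℂ} (hf : f ∈ smoothVanishing)
    (ε : ℝ) {s : ℝ} (hs : s ∈ Ioo 0 (beta ε)) :
    HasDerivAt (transform ε f) (transformDer ε f s + theta ε s • transform ε f s) s := by
  have hfd := ((contDiffAt_of_smooth hf (phi_mem ε hs)).differentiableAt (by norm_num)).hasDerivAt
  have h : HasDerivAt (transform ε f) _ s :=
    (hasDerivAt_amp_phi ε hs).fun_smul (hfd.scomp s (hasDerivAt_phi ε hs))
  refine h.congr_deriv ?_
  simp only [transformDer, transform, smul_smul]

theorem contDiffOn_transformDer {f : ℝ → ℂ} (hf : f ∈ smoothVanishing) (ε : ℝ) :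
    ContDiffOn ℝ ∞ (transformDer ε f) (Ioo 0 (beta ε)) := by
  have h : ContDiffOn ℝ ∞ (deriv f) (Ioo 0 1) :=
    (hf.1.mono Ioo_subset_Icc_self).deriv_of_isOpen isOpen_Ioo (by norm_cast)
  exact (((contDiffOn_amp ε).mul contDiffOn_rho).comp (contDiffOn_phi ε)
    fun _ hs => phi_mem ε hs).smul (h.comp (contDiffOn_phi ε) fun _ hs => phi_mem ε hs)

/-- The second half of the factorization of `L`: `transformDer` equals `a⁻¹ (p f') ∘ φ`, and
differentiating `a⁻¹` produces the term cancelled by `θ`. -/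
theorem deriv_transformDer {f : ℝ → ℂ} (hf : f ∈ smoothVanishing)
    (ε : ℝ) {s : ℝ} (hs : s ∈ Ioo 0 (beta ε)) :
    transform ε (slExpr ε f) s =
      -(deriv (transformDer ε f) s + theta ε s • transformDer ε f s) := by
  have hx := phi_mem ε hs
  have ha := (amp_pos ε hx).ne'
  have hd : HasDerivAt (fun y => p ε y • deriv f y)
      (deriv (fun y => p ε y • deriv f y) (phi ε s)) (phi ε s) :=
    ((hasDerivAt_p ε hx).differentiableAt.fun_smul (differentiableAt_deriv hf hx)).hasDerivAt
  have e : ∀ t ∈ Ioo 0 (beta ε), transformDer ε f t =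
      (amp ε (phi ε t))⁻¹ • (p ε (phi ε t) • deriv f (phi ε t)) := by
    intro t ht
    have hx := phi_mem ε ht
    have ha := (amp_pos ε hx).ne'
    have hp : p ε (phi ε t) = rho (phi ε t) * amp ε (phi ε t) ^ 2 := by
      rw [amp_sq ε hx, p_eq_rho_sq ε hx]
      ring
    rw [transformDer, smul_smul, hp]
    congr 1
    field_simp
  have h1 : HasDerivAt (fun t => (amp ε (phi ε t))⁻¹ • (p ε (phi ε t) • deriv f (phi ε t))) _ s :=
    ((hasDerivAt_amp_phi ε hs).inv ha).fun_smul (hd.scomp s (hasDerivAt_phi ε hs))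
  have h2 := h1.congr_of_eventuallyEq (eventually_of_mem (isOpen_Ioo.mem_nhds hs) e)
  have hw := (w_pos ε hx).ne'
  have hr := (rho_pos hx).ne'
  rw [h2.deriv, e s hs, transform, slExpr]
  simp only [smul_smul, Pi.inv_apply]
  have e1 : amp ε (phi ε s) * (w ε (phi ε s))⁻¹ = (amp ε (phi ε s))⁻¹ * rho (phi ε s) := by
    have := amp_sq ε hx
    field_simp
    linarith
  have e2 : -(theta ε s * amp ε (phi ε s)) / amp ε (phi ε s) ^ 2 * p ε (phi ε s) =
      -(theta ε s * (amp ε (phi ε s))⁻¹ * p ε (phi ε s)) := by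
    field_simp
  rw [smul_neg, smul_smul, e1, ← mul_assoc, e2]
  rw [neg_smul]
  abel

theorem memLp_transformDer {f : ℝ → ℂ} (hf : f ∈ smoothVanishing) {ε : ℝ} (hε : 0 < ε) :
    MemLp (transformDer ε f) 2 (volume.restrict (Ioo 0 (beta ε))) := by
  obtain ⟨A, hA⟩ := exists_bound_of_smoothVanishing hf
  refine MemLp.of_bound
    ((contDiffOn_transformDer hf ε).continuousOn.aestronglyMeasurable measurableSet_Ioo)
    (Real.sqrt 2 * A) ?_
  filter_upwards [ae_restrict_mem measurableSet_Ioo] with s hs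
  have hx := phi_mem ε hs
  have h1 : 0 < 1 - phi ε s := by linarith [hx.2]
  have hp : p ε (phi ε s) ≤ 2 := by
    refine (p_le hε hx).trans (mul_le_of_le_one_right zero_le_two ?_)
    exact Real.rpow_le_one h1.le (by linarith [hx.1]) (by positivity)
  rw [transformDer, norm_smul]
  refine mul_le_mul ?_ (hA _ hx).2 (norm_nonneg _) (Real.sqrt_nonneg _)
  refine Real.le_sqrt_of_sq_le ?_
  rw [Real.norm_eq_abs, sq_abs, amp_mul_rho_sq ε hx]
  calc p ε (phi ε s) * rho (phi ε s) ≤ 2 * 1 :=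
        mul_le_mul hp (rho_le_one hx) (rho_pos hx).le zero_le_two
    _ = 2 := by norm_num

theorem support_cutoff_transform (ε : ℝ) (n : ℕ) (f : ℝ → ℂ) :
    Function.support ((Ioo 0 (beta ε)).indicator
      fun s => cutoff (n + 1) (phi ε s) • transform ε f s) ⊆
        psi ε '' Icc (1 / (n + 1 : ℝ)) (1 - 1 / (n + 1)) := by
  intro s hs
  have h1 : s ∈ Ioo 0 (beta ε) := by
    by_contra h
    exact hs (indicator_of_notMem h _)
  refine ⟨phi ε s, mem_Icc_of_cutoff_ne_zero (by positivity) fun h => hs ?_,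
    psi_phi ε (Ioo_subset_Icc_self h1)⟩
  simp only [indicator_of_mem h1, h, zero_smul]

theorem Icc_inv_subset_Ioo (n : ℕ) : Icc (1 / (n + 1 : ℝ)) (1 - 1 / (n + 1)) ⊆ Ioo 0 1 :=
  fun x hx => by
    have : (0 : ℝ) < 1 / (n + 1) := by positivity
    exact ⟨by linarith [hx.1], by linarith [hx.2]⟩

theorem isCompact_image_psi (ε : ℝ) (n : ℕ) :
    IsCompact (psi ε '' Icc (1 / (n + 1 : ℝ)) (1 - 1 / (n + 1))) :=
  isCompact_Icc.image_of_continuousOn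
    ((continuousOn_psi ε).mono ((Icc_inv_subset_Ioo n).trans Ioo_subset_Icc_self))

theorem tsupport_cutoff_transform (ε : ℝ) (n : ℕ) (f : ℝ → ℂ) :
    tsupport ((Ioo 0 (beta ε)).indicator
      fun s => cutoff (n + 1) (phi ε s) • transform ε f s) ⊆ Ioo 0 (beta ε) := by
  refine (closure_minimal (support_cutoff_transform ε n f) (isCompact_image_psi ε n).isClosed).trans
    ?_
  rw [← image_psi ε]
  exact image_mono (Icc_inv_subset_Ioo n)

/-- the function `χ F` for `F = c⁻¹ f ∘ φ` and a cutoff function `χ` -/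
def cutoffTest {f : ℝ → ℂ} (hf : f ∈ smoothVanishing) (ε : ℝ) (n : ℕ) : Test (beta ε) where
  toFun := (Ioo 0 (beta ε)).indicator fun s => cutoff (n + 1) (phi ε s) • transform ε f s
  contDiff' := contDiff_of_tsupport_subset isOpen_Ioo ((((contDiff_cutoff (n + 1)).comp_contDiffOn
    (contDiffOn_phi ε)).smul (contDiffOn_transform hf ε)).congr
      fun _ hs => indicator_of_mem hs _) (tsupport_cutoff_transform ε n f)
  hasCompactSupport' := HasCompactSupport.of_support_subset_isCompact (isCompact_image_psi ε n)
    (support_cutoff_transform ε n f)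
  tsupport_subset' := tsupport_cutoff_transform ε n f

theorem cutoffTest_apply {f : ℝ → ℂ} (hf : f ∈ smoothVanishing)
    (ε : ℝ) (n : ℕ) {s : ℝ} (hs : s ∈ Ioo 0 (beta ε)) :
    cutoffTest hf ε n s = cutoff (n + 1) (phi ε s) • transform ε f s :=
  indicator_of_mem hs fun s => cutoff (n + 1) (phi ε s) • transform ε f s

/-- Leibniz rule: the terms with `θ` cancel, and the only error is the derivative of the cutoff
times the transform. -/
theorem twist_cutoffTest {f : ℝ → ℂ} (hf : f ∈ smoothVanishing)
    (ε : ℝ) (n : ℕ) {s : ℝ} (hs : s ∈ Ioo 0 (beta ε)) :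
    Test.twist (contDiffOn_theta ε) (cutoffTest hf ε n) s =
      cutoff (n + 1) (phi ε s) • transformDer ε f s +
        (cutoffDer (n + 1) (phi ε s) * rho (phi ε s)) • transform ε f s := by
  have e : cutoffTest hf ε n =ᶠ[𝓝 s] fun s => cutoff (n + 1) (phi ε s) • transform ε f s :=
    eventually_of_mem (isOpen_Ioo.mem_nhds hs) fun t ht => cutoffTest_apply hf ε n ht
  have d : HasDerivAt (fun s => cutoff (n + 1) (phi ε s) • transform ε f s) _ s :=
    ((hasDerivAt_cutoff (n + 1) _).comp s (hasDerivAt_phi ε hs)).fun_smul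
      (hasDerivAt_transform hf ε hs)
  rw [Test.twist_apply, e.deriv_eq, d.deriv, cutoffTest_apply hf ε n hs]
  simp only [smul_add, smul_smul, Function.comp]
  rw [mul_comm (theta ε s)]
  abel

theorem tendsto_cutoffTest {f : ℝ → ℂ} (hf : f ∈ smoothVanishing)
    (ε : ℝ) (h : MemLp (transform ε f) 2 (volume.restrict (Ioo 0 (beta ε)))) :
    Tendsto (fun n => (cutoffTest hf ε n).toL2) atTop (𝓝 (h.toLp (transform ε f))) := by
  refine tendsto_toLp_of_dominated (fun n => Test.memLp _) h
    ((memLp_two_iff_integrable_sq_norm h.1).1 h) (fun n => ?_) ?_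
  · filter_upwards [ae_restrict_mem measurableSet_Ioo] with s hs
    rw [cutoffTest_apply hf ε n hs, ← one_smul ℝ (transform ε f s), smul_smul, ← sub_smul,
      norm_smul, one_smul, mul_one]
    refine pow_le_pow_left₀ (by positivity) (mul_le_of_le_one_left (norm_nonneg _) ?_) 2
    rw [Real.norm_eq_abs, abs_le]
    constructor <;> linarith [cutoff_nonneg (n + 1) (phi ε s), cutoff_le_one (n + 1) (phi ε s)]
  · filter_upwards [ae_restrict_mem measurableSet_Ioo] with s hs
    filter_upwards [eventually_cutoff (phi_mem ε hs)] with n hn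
    rw [cutoffTest_apply hf ε n hs, hn.1, one_smul]

/-- At `0` the linear vanishing of `f` compensates the cutoff derivative. At `1` its square costs
`(1 - x)^{-2}`, paid for by the decay `(1 - x)^{1 + 1/ε}` of `p`, so no boundary condition is needed
there. -/
theorem norm_cutoffDer_smul_transform_sq_le {f : ℝ → ℂ} (hf : f ∈ smoothVanishing)
    {ε : ℝ} (hε : 0 < ε) :
    ∃ C : ℝ, ∀ N : ℝ, ∀ s ∈ Ioo 0 (beta ε),
      ‖(cutoffDer N (phi ε s) * rho (phi ε s)) • transform ε f s‖ ^ 2 ≤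
        C * (rho (phi ε s) * (1 - phi ε s) ^ (1 / ε - 1)) := by
  obtain ⟨A, hA⟩ := exists_bound_of_smoothVanishing hf
  obtain ⟨M, hM⟩ := exists_bound_deriv_step
  refine ⟨2 * (M * A) ^ 2, fun N s hs => ?_⟩
  have hx := phi_mem ε hs
  set x := phi ε s with hxs
  have h1 : 0 < 1 - x := by linarith [hx.2]
  have hA0 : 0 ≤ A := (norm_nonneg _).trans (hA x hx).2
  have k1 : |cutoffDer N x| * ‖f x‖ ≤ M * A / (1 - x) := by
    calc |cutoffDer N x| * ‖f x‖ ≤ |cutoffDer N x| * (A * x) := by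
          gcongr
          exact (hA x hx).1
      _ = A * (|cutoffDer N x| * x) := by ring
      _ ≤ A * (M / (1 - x)) := by
          gcongr
          exact abs_cutoffDer_mul_le hM hx
      _ = M * A / (1 - x) := by ring
  have e : ‖(cutoffDer N x * rho x) • transform ε f s‖ ^ 2 =
      p ε x * rho x * (|cutoffDer N x| * ‖f x‖) ^ 2 := by
    rw [transform, ← hxs, smul_smul, norm_smul, mul_pow, Real.norm_eq_abs, sq_abs,
      ← amp_mul_rho_sq ε hx, mul_pow |_|, sq_abs]
    ring
  have e2 : (1 - x) ^ (1 + 1 / ε) = (1 - x) ^ (1 / ε - 1) * (1 - x) ^ 2 := by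
    rw [← Real.rpow_natCast (1 - x) 2, ← Real.rpow_add h1]
    congr 1
    push_cast
    ring
  have hr := (rho_pos hx).le
  calc ‖(cutoffDer N x * rho x) • transform ε f s‖ ^ 2
      ≤ 2 * (1 - x) ^ (1 + 1 / ε) * rho x * (M * A / (1 - x)) ^ 2 := by
        rw [e]
        gcongr
        exact p_le hε hx
    _ = _ := by
        rw [e2]
        field_simp

theorem tendsto_twist_cutoffTest {f : ℝ → ℂ} (hf : f ∈ smoothVanishing) {ε : ℝ} (hε : 0 < ε) :
    Tendsto (fun n => (Test.twist (contDiffOn_theta ε) (cutoffTest hf ε n)).toL2) atTop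
      (𝓝 ((memLp_transformDer hf hε).toLp (transformDer ε f))) := by
  obtain ⟨C, hC⟩ := norm_cutoffDer_smul_transform_sq_le hf hε
  have hG := memLp_transformDer hf hε
  refine tendsto_toLp_of_dominated (fun n => Test.memLp _) hG
    ((((memLp_two_iff_integrable_sq_norm hG.1).1 hG).const_mul 2).add
      (((integrableOn_rpow_phi hε).const_mul C).const_mul 2)) (fun n => ?_) ?_
  · filter_upwards [ae_restrict_mem measurableSet_Ioo] with s hs
    rw [twist_cutoffTest hf ε n hs]
    have h1 : ‖cutoff (n + 1) (phi ε s) • transformDer ε f s - transformDer ε f s‖ ≤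
        ‖transformDer ε f s‖ := by
      rw [← one_smul ℝ (transformDer ε f s), smul_smul, ← sub_smul, norm_smul, one_smul, mul_one]
      refine mul_le_of_le_one_left (norm_nonneg _) ?_
      rw [Real.norm_eq_abs, abs_le]
      constructor <;> linarith [cutoff_nonneg (n + 1) (phi ε s), cutoff_le_one (n + 1) (phi ε s)]
    have h2 := hC (n + 1) s hs
    rw [add_sub_right_comm]
    set a := cutoff (n + 1) (phi ε s) • transformDer ε f s - transformDer ε f s
    set b := (cutoffDer (n + 1) (phi ε s) * rho (phi ε s)) • transform ε f s
    have h3 : ‖a + b‖ ^ 2 ≤ (‖a‖ + ‖b‖) ^ 2 :=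
      pow_le_pow_left₀ (norm_nonneg _) (norm_add_le a b) 2
    have h4 : ‖a‖ ^ 2 ≤ ‖transformDer ε f s‖ ^ 2 := pow_le_pow_left₀ (norm_nonneg _) h1 2
    simp only [Pi.add_apply]
    nlinarith [sq_nonneg (‖a‖ - ‖b‖)]
  · filter_upwards [ae_restrict_mem measurableSet_Ioo] with s hs
    filter_upwards [eventually_cutoff (phi_mem ε hs)] with n hn
    rw [twist_cutoffTest hf ε n hs, hn.1, hn.2, one_smul, zero_mul, zero_smul, add_zero]

/-! ### The Schrödinger operator -/

/-- the closure of the range of `g ↦ g' - θ g` in `L²(0, β)` -/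
abbrev TwistSpace (ε : ℝ) : Type :=
  (LinearMap.range (Test.toL2ₗ (beta ε) ∘ₗ Test.twist (contDiffOn_theta ε))).topologicalClosure

/-- the operator `g ↦ g' - θ g` with values in the closure of its range -/
def twistOp (ε : ℝ) : Test (beta ε) →ₗ[ℂ] TwistSpace ε :=
  (Test.toL2ₗ (beta ε) ∘ₗ Test.twist (contDiffOn_theta ε)).codRestrict _
    fun g => Submodule.le_topologicalClosure _ ⟨g, rfl⟩

theorem denseRange_twistOp (ε : ℝ) : DenseRange (twistOp ε) := by
  rintro ⟨v, hv⟩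
  rw [closure_subtype, ← range_comp]
  exact hv

theorem schrodingerForm_eq_norm_sq (ε : ℝ) : schrodingerForm ε = fun g => ‖twistOp ε g‖ ^ 2 :=
  funext fun g => (schrodingerForm_eq ε g).2

theorem twistOp_closable (ε : ℝ) (u : ℕ → Test (beta ε)) (v : TwistSpace ε)
    (hu : Tendsto (fun n => Test.toL2ₗ (beta ε) (u n)) atTop (𝓝 0))
    (hv : Tendsto (fun n => twistOp ε (u n)) atTop (𝓝 v)) : v = 0 :=
  Subtype.ext (Test.twist_closable (contDiffOn_theta ε) u v hu
    ((continuous_subtype_val.tendsto v).comp hv))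

theorem norm_toL2_le {ε : ℝ} (hε : 0 < ε) (g : Test (beta ε)) :
    ‖Test.toL2ₗ (beta ε) g‖ ≤ Real.sqrt (ε / 2) * ‖twistOp ε g‖ := by
  refine Real.le_sqrt_of_sq_le (poincare hε g) |>.trans_eq ?_
  rw [Real.sqrt_mul (by positivity), Real.sqrt_sq (norm_nonneg _)]
  rfl

/-- the closure of the map `g' - θ g ↦ g` -/
def twistInv (ε : ℝ) : TwistSpace ε →L[ℂ] L2 (beta ε) :=
  (Test.toL2ₗ (beta ε)).extendOfNorm (twistOp ε)

theorem twistInv_twistOp {ε : ℝ} (hε : 0 < ε) (g : Test (beta ε)) :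
    twistInv ε (twistOp ε g) = Test.toL2ₗ (beta ε) g :=
  LinearMap.extendOfNorm_eq (denseRange_twistOp ε) ⟨_, norm_toL2_le hε⟩ g

theorem injective_twistInv {ε : ℝ} (hε : 0 < ε) : Function.Injective (twistInv ε) :=
  injective_of_closable (denseRange_twistOp ε) (twistInv_twistOp hε) (twistOp_closable ε)

theorem denseRange_twistInv {ε : ℝ} (hε : 0 < ε) : DenseRange (twistInv ε) :=
  Test.denseRange_toL2.mono (by
    rintro _ ⟨g, rfl⟩
    exact ⟨twistOp ε g, twistInv_twistOp hε g⟩)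

/-- Cutoffs place the transform of `f` in the form domain, with `transformDer` as its image under
the closure of `A`; pairing that image with `A g` and integrating by parts gives the weak equation.
-/
theorem transform_mem_graph {ε : ℝ} (hε : 0 < ε) {P : L2w ε × L2w ε} (hP : P ∈ slGraph ε) :
    (transformEquiv hε P.1, transformEquiv hε P.2) ∈ (formOperator (twistInv ε)).graph := by
  obtain ⟨f, hf, h1, h2⟩ := hP
  have m1 : MemLp (transform ε f) 2 (volume.restrict (Ioo 0 (beta ε))) :=
    memLp_transform ε ((memLp_congr_ae h1).1 (Lp.memLp P.1))
  have m2 : MemLp (transform ε (slExpr ε f)) 2 (volume.restrict (Ioo 0 (beta ε))) :=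
    memLp_transform ε ((memLp_congr_ae h2).1 (Lp.memLp P.2))
  have e1 : transformEquiv hε P.1 = m1.toLp _ :=
    Lp.ext ((transformLI_ae_of_ae ε h1).trans m1.coeFn_toLp.symm)
  have e2 : transformEquiv hε P.2 = m2.toLp _ :=
    Lp.ext ((transformLI_ae_of_ae ε h2).trans m2.coeFn_toLp.symm)
  rw [e1, e2]
  have mG := memLp_transformDer hf hε
  have hv := tendsto_twist_cutoffTest hf hε
  have hmem : mG.toLp (transformDer ε f) ∈
      (LinearMap.range (Test.toL2ₗ (beta ε) ∘ₗ
        Test.twist (contDiffOn_theta ε))).topologicalClosure :=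
    mem_closure_of_tendsto hv (Eventually.of_forall fun n => ⟨cutoffTest hf ε n, rfl⟩)
  refine mem_formOperator_graph_of_tendsto (denseRange_twistOp ε) (twistInv_twistOp hε)
    (injective_twistInv hε) (denseRange_twistInv hε) (v := ⟨_, hmem⟩)
    (u := cutoffTest hf ε) (tendsto_cutoffTest hf ε m1) (tendsto_subtype_rng.2 hv) fun g => ?_
  exact Test.inner_twist (contDiffOn_theta ε) g
    ((contDiffOn_transformDer hf ε).of_le (by norm_cast)) mG m2
    fun s hs => deriv_transformDer hf ε hs

/-- The transformed graph of `L` lies in the graph of `H`, and its second components include all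
test functions; boundedness of `H⁻¹` then makes it a core. -/
theorem closure_image_slGraph {ε : ℝ} (hε : 0 < ε) :
    closure (Prod.map (transformEquiv hε) (transformEquiv hε) '' (slGraph ε : Set _)) =
      ((formOperator (twistInv ε)).graph : Set (L2 (beta ε) × L2 (beta ε))) := by
  refine inverseOp_graph_eq_closure
    (injective_comp_adjoint (injective_twistInv hε) (denseRange_twistInv hε)) ?_ ?_
  · rintro _ ⟨P, hP, rfl⟩
    exact transform_mem_graph hε hP
  · refine Test.denseRange_toL2.mono ?_
    rintro _ ⟨h, rfl⟩
    obtain ⟨P, hP, e⟩ := exists_slGraph_transform hε h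
    exact ⟨_, ⟨P, hP, rfl⟩, e⟩

theorem mem_closure_slGraph_iff {ε : ℝ} (hε : 0 < ε) (f h : L2w ε) :
    (f, h) ∈ closure (slGraph ε : Set (L2w ε × L2w ε)) ↔
      (transformEquiv hε f, transformEquiv hε h) ∈ (formOperator (twistInv ε)).graph := by
  have e := ((transformEquiv hε).toHomeomorph.prodCongr
    (transformEquiv hε).toHomeomorph).image_closure (slGraph ε : Set (L2w ε × L2w ε))
  have e' := e.trans (closure_image_slGraph hε)
  rw [← SetLike.mem_coe, ← e']
  exact (Function.Injective.mem_set_image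
    ((transformEquiv hε).toHomeomorph.prodCongr (transformEquiv hε).toHomeomorph).injective).symm

/-- The closure of the graph is carried by `U` into the graph of an operator, hence is single
valued. -/
theorem isClosable_sturmLiouville {ε : ℝ} (hε : 0 < ε) : (sturmLiouville ε).IsClosable := by
  refine ⟨(sturmLiouville ε).graph.topologicalClosure.toLinearPMap, ?_⟩
  refine (Submodule.toLinearPMap_graph_eq _ ?_).symm
  rintro ⟨f, h⟩ hfh (rfl : f = 0)
  rw [sturmLiouville_graph] at hfh
  have := (mem_closure_slGraph_iff hε 0 h).1 hfh
  rw [map_zero] at this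
  exact (transformEquiv hε).map_eq_zero_iff.1 (LinearPMap.graph_fst_eq_zero_snd _ this rfl)

theorem mem_closure_sturmLiouville_iff {ε : ℝ} (hε : 0 < ε) (f h : L2w ε) :
    (f, h) ∈ (sturmLiouville ε).closure.graph ↔
      (transformEquiv hε f, transformEquiv hε h) ∈ (formOperator (twistInv ε)).graph := by
  rw [← (isClosable_sturmLiouville hε).graph_closure_eq_closure_graph, sturmLiouville_graph,
    ← mem_closure_slGraph_iff hε]
  rfl

end LiouvilleSchrodinger

end

/-! ### Assembly of the main theorem. -/

open LiouvilleSchrodinger in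
theorem mainTheorem6 (ε : ℝ) (hε₀ : 0 < ε) (hε₂ : ε < 2) :
    -- `β < ∞`, and the change of variables is well defined and smooth
    IntervalIntegrable (fun y => Real.sqrt (w ε y / p ε y)) volume 0 1 ∧
    Set.BijOn (psi ε) (Set.Icc 0 1) (Set.Icc 0 (beta ε)) ∧
    ContDiffOn ℝ ∞ (phi ε) (Set.Ioo 0 (beta ε)) ∧
    (∀ s ∈ Set.Ioo 0 (beta ε), deriv (phi ε) s ≠ 0) ∧
    ContDiffOn ℝ ∞ (c ε) (Set.Ioo 0 (beta ε)) ∧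
    -- the form on the test functions is well defined, nonnegative and closable
    (∀ g : Test (beta ε),
      IntegrableOn (schrodingerDensity ε g) (Set.Ioo 0 (beta ε)) ∧ 0 ≤ schrodingerForm ε g) ∧
    IsClosableForm (Test.toL2 (b := beta ε)) (schrodingerForm ε) ∧
    -- its closure is associated with a self-adjoint operator, unitarily equivalent to `L̄`
    (sturmLiouville ε).IsClosable ∧
    (∃ (Q : SesqForm (L2 (beta ε))) (H : L2 (beta ε) →ₗ.[ℂ] L2 (beta ε))
        (U : L2w ε ≃ₗᵢ[ℂ] L2 (beta ε)),
      Q.IsClosureOf Test.toL2 (schrodingerForm ε) ∧ Q.IsClosed ∧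
      Q.IsAssociated H ∧ IsSelfAdjoint H ∧
      (∀ f : L2w ε, U f =ᵐ[volume.restrict (Set.Ioo 0 (beta ε))]
        fun s => (c ε s)⁻¹ • f (phi ε s)) ∧
      ∀ f h : L2w ε, (f, h) ∈ (sturmLiouville ε).closure.graph ↔ (U f, U h) ∈ H.graph) ∧
    -- the potential
    ContDiffOn ℝ ∞ (V ε) (Set.Ioo 0 (beta ε)) ∧
    Asymptotics.IsEquivalent (𝓝[>] 0) (V ε) (fun s => 3 / 4 * s ^ (-2 : ℤ)) ∧
    Asymptotics.IsEquivalent (𝓝[<] (beta ε)) (V ε)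
      (fun s => (1 / ε ^ 2 - 1 / 4) * (beta ε - s) ^ (-2 : ℤ)) := by
  refine ⟨intervalIntegrable_sqrt ε, bijOn_psi ε, contDiffOn_phi ε, fun s hs => ?_,
    contDiffOn_c ε, fun g => ⟨(schrodingerForm_eq ε g).1, ?_⟩, ?_, isClosable_sturmLiouville hε₀,
    ⟨rangeForm (twistInv ε) (injective_twistInv hε₀), formOperator (twistInv ε),
      transformEquiv hε₀, ?_, rangeForm_isClosed _ _,
      rangeForm_isAssociated (injective_twistInv hε₀) (denseRange_twistInv hε₀),
      isSelfAdjoint_formOperator (injective_twistInv hε₀) (denseRange_twistInv hε₀),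
      transformEquiv_ae hε₀, mem_closure_sturmLiouville_iff hε₀⟩,
    contDiffOn_V ε, isEquivalent_V_zero ε, isEquivalent_V_beta hε₀ hε₂⟩
  · rw [(hasDerivAt_phi ε hs).deriv]
    exact (rho_pos (phi_mem ε hs)).ne'
  · rw [(schrodingerForm_eq ε g).2]
    positivity
  · rw [schrodingerForm_eq_norm_sq]
    exact isClosableForm_of (ι := Test.toL2ₗ (beta ε)) (twistOp_closable ε)
  · rw [schrodingerForm_eq_norm_sq]
    exact rangeForm_isClosureOf (ι := Test.toL2ₗ (beta ε)) (denseRange_twistOp ε)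
      (twistInv_twistOp hε₀) (injective_twistInv hε₀)
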